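/- Let $k$ be an algebraically closed field of characteristic zero. For a finite-dimensional Hopf algebra $H$ over $k$ with antipode $S$ and an integer $n \ge 1$, the $n$-th indicator of $H$ is $\nu_n(H) = \mathrm{Tr}\big(H \to H,\ h \mapsto S(h^{[n-1]})\big) \in k$, where $h^{[0]} = \varepsilon(h)1$ and $h^{[m]} = h_{(1)} \cdots h_{(m)}$ for $m \ge 1$. For a primitive $N$-th root of unity $\omega \in k$, $N > 1$, the Taft algebra $T_{N^2}(\omega)$ is the Hopf algebra generated as an algebra by $x$ and $g$ with relations $x^N = 0$, $g^N = 1$, $g x = \omega x g$, and with $\Delta(x) = x \otimes 1 + g \otimes x$, $\varepsilon(x) = 0$, $\Delta(g) = g \otimes g$, $\varepsilon(g) = 1$, $S(x) = -g^{-1}x$, $S(g) = g^{-1}$. For a root of unity $q \in k$ of odd order $N > 1$, the Hopf algebra $u_q(\mathfrak{sl}_2)$ is generated as an algebra by $E$, $F$ and $K$ with relations $E^N = F^N = 0$, $K^N = 1$, $KE = q^2 EK$, $KF = q^{-2} FK$ and $EF - FE = \dfrac{K - K^{N-1}}{q - q^{-1}}$, and with $\Delta(E) = E \otimes 1 + K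 \otimes E$, $\Delta(F) = F \otimes K^{-1} + 1 \otimes F$, $\Delta(K) = K \otimes K$ (so $\varepsilon(E) = \varepsilon(F) = 0$, $\varepsilon(K) = 1$). Let $\mathcal{O} \subset k$ be the subring generated by all roots of unity in $k$. Every $z \in \mathcal{O}$ has the form $z = \sum_i a_i \omega_i$ with $a_i \in \mathbb{Z}$ and $\omega_i$ roots of unity; put $\overline{z} = \sum_i a_i \omega_i^{-1}$, which is independent of the chosen expression, and $|z|^2 = z\,\overline{z}$. **Theorem.** Let $q \in k$ be a root of unity of odd order $N > 1$. Then, for all $n \ge 1$, $\nu_n(T_{N^2}(q^2))$ lies in $\mathcal{O}$ (so that $|\nu_n(T_{N^2}(q^2))|^2$ is defined) and $$\nu_n(u_q(\mathfrak{sl}_2)) = \frac{1}{\gcd(N, n)}\, \big| \nu_n(T_{N^2}(q^2)) \big|^2 .$$ -/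

import Mathlib

open scoped TensorProduct

namespace HopfIndicator

noncomputable section

/-! ### Indicators of finite-dimensional Hopf algebras -/

/-- The `m`-th Sweedler power map `h ↦ h₍₁₎ ⋯ h₍ₘ₎` (with `h ↦ ε(h) 1` for `m = 0`): the `m`-th power
of the identity map for the convolution product. -/
def sweedlerPower (k H : Type*) [Field k] [Ring H] [HopfAlgebra k H] (m : ℕ) : H →ₗ[k] H :=
  (WithConv.toConv (LinearMap.id : H →ₗ[k] H) ^ m).ofConv

/-- The `n`-th indicator (`n ≥ 1`) of a finite-dimensional Hopf algebra: the trace of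
`h ↦ S(h^{[n-1]})`. -/
def indicator (k H : Type*) [Field k] [Ring H] [HopfAlgebra k H] [Module.Finite k H] (n : ℕ) : k :=
  LinearMap.trace k H (HopfAlgebra.antipode k ∘ₗ sweedlerPower k H (n - 1))

/-! ### The ring generated by the roots of unity and its conjugation -/

section Conj

variable (k : Type*) [Field k]

/-- `∑ aᵢ [ωᵢ] ↦ ∑ aᵢ ωᵢ`, on formal integral combinations of roots of unity of `k`. -/
def evalRoots : MonoidAlgebra ℤ (CommGroup.torsion kˣ) →+* k :=
  ((MonoidAlgebra.lift ℤ k (CommGroup.torsion kˣ))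
    ((Units.coeHom k).comp (CommGroup.torsion kˣ).subtype)).toRingHom

/-- `∑ aᵢ [ωᵢ] ↦ ∑ aᵢ ωᵢ⁻¹`, on formal integral combinations of roots of unity of `k`. -/
def evalRootsInv : MonoidAlgebra ℤ (CommGroup.torsion kˣ) →+* k :=
  ((MonoidAlgebra.lift ℤ k (CommGroup.torsion kˣ))
    (((Units.coeHom k).comp (CommGroup.torsion kˣ).subtype).comp
      (invMonoidHom : CommGroup.torsion kˣ →* CommGroup.torsion kˣ))).toRingHom

/-- The subring of `k` of all finite sums `∑ aᵢ ωᵢ` with `aᵢ ∈ ℤ` and `ωᵢ` roots of unity. -/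
def cyclotomicSubring : Subring k := (evalRoots k).range

variable {k}

theorem evalRoots_apply (z : MonoidAlgebra ℤ (CommGroup.torsion kˣ)) :
    evalRoots k z = z.coeff.sum fun ζ a => (a : k) * ((ζ : kˣ) : k) := by
  simp [evalRoots, MonoidAlgebra.lift_apply, zsmul_eq_mul]

theorem evalRootsInv_apply (z : MonoidAlgebra ℤ (CommGroup.torsion kˣ)) :
    evalRootsInv k z = z.coeff.sum fun ζ a => (a : k) * ((ζ : kˣ) : k)⁻¹ := by
  simp [evalRootsInv, MonoidAlgebra.lift_apply, zsmul_eq_mul]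

theorem ker_evalRoots_le [CharZero k] :
    RingHom.ker (evalRoots k) ≤ RingHom.ker (evalRootsInv k) := by
  have : Algebra.IsAlgebraic ℚ (algebraicClosure ℚ k) := algebraicClosure.isAlgebraic ℚ k
  let φ : algebraicClosure ℚ k →ₐ[ℚ] ℂ := IsAlgClosed.lift
  have hmem : ∀ ζ : CommGroup.torsion kˣ, ((ζ : kˣ) : k) ∈ algebraicClosure ℚ k := by
    intro ζ
    obtain ⟨m, hm, hζ⟩ := isOfFinOrder_iff_pow_eq_one.mp ζ.2
    have h1 : ((ζ : kˣ) : k) ^ m = 1 := by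
      rw [← Units.val_pow_eq_pow_val, hζ, Units.val_one]
    have : IsIntegral ℚ ((ζ : kˣ) : k) :=
      IsIntegral.of_pow hm (by rw [h1]; exact isIntegral_one)
    exact mem_algebraicClosure_iff.mpr this.isAlgebraic
  have hnorm : ∀ ζ : CommGroup.torsion kˣ,
      starRingEnd ℂ (φ ⟨_, hmem ζ⟩) = φ (⟨_, hmem ζ⟩)⁻¹ := by
    intro ζ
    obtain ⟨m, hm, hζ⟩ := isOfFinOrder_iff_pow_eq_one.mp ζ.2
    have h1 : ((ζ : kˣ) : k) ^ m = 1 := by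
      rw [← Units.val_pow_eq_pow_val, hζ, Units.val_one]
    have h2 : (φ ⟨_, hmem ζ⟩) ^ m = 1 := by
      rw [← map_pow, show (⟨_, hmem ζ⟩ : algebraicClosure ℚ k) ^ m = 1 from Subtype.ext h1, map_one]
    have h3 : ‖φ ⟨_, hmem ζ⟩‖ = 1 := Complex.norm_eq_one_of_pow_eq_one h2 hm.ne'
    rw [map_inv₀, Complex.inv_eq_conj h3]
  intro z hz
  rw [RingHom.mem_ker, evalRoots_apply] at hz
  rw [RingHom.mem_ker, evalRootsInv_apply]
  have e1 : (z.coeff.sum fun ζ a => (a : algebraicClosure ℚ k) * (⟨_, hmem ζ⟩ : algebraicClosure ℚ k)) = 0 := by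
    apply Subtype.ext
    rw [ZeroMemClass.coe_zero, ← hz]
    simp [Finsupp.sum]
  have e2 : (z.coeff.sum fun ζ a => (a : algebraicClosure ℚ k) * (⟨_, hmem ζ⟩ : algebraicClosure ℚ k)⁻¹) = 0 := by
    apply φ.injective
    have := congrArg (fun t => starRingEnd ℂ (φ t)) e1
    simp only [Finsupp.sum, map_sum, map_mul, map_intCast, map_zero, hnorm] at this ⊢
    exact this
  have := congrArg (fun t : algebraicClosure ℚ k => (t : k)) e2
  simpa [Finsupp.sum] using this

variable [CharZero k]

/-- The conjugation `z = ∑ aᵢ ωᵢ ↦ z̄ = ∑ aᵢ ωᵢ⁻¹` (see `cyclotomicConj_evalRoots`). -/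
def cyclotomicConj : cyclotomicSubring k →+* k :=
  RingHom.liftOfSurjective (evalRoots k).rangeRestrict (evalRoots k).rangeRestrict_surjective
    ⟨evalRootsInv k, by
      rw [RingHom.ker_rangeRestrict]; exact ker_evalRoots_le⟩

theorem cyclotomicConj_evalRoots (z : MonoidAlgebra ℤ (CommGroup.torsion kˣ)) :
    cyclotomicConj ⟨evalRoots k z, z, rfl⟩ = evalRootsInv k z :=
  RingHom.liftOfRightInverse_comp_apply _ _ _ _ z

/-- `|z|² = z z̄`. -/
def absSq (z : cyclotomicSubring k) : k := (z : k) * cyclotomicConj z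

end Conj

/-! ### Auxiliary facts on `q`-commuting elements -/

section QComm

variable {k : Type*} [Field k]

/-- Gaussian binomial coefficients. -/
def qChoose (ω : k) : ℕ → ℕ → k
  | _, 0 => 1
  | 0, _ + 1 => 0
  | n + 1, i + 1 => qChoose ω n i + ω ^ (i + 1) * qChoose ω n (i + 1)

theorem qChoose_zero_right (ω : k) (n : ℕ) : qChoose ω n 0 = 1 := by cases n <;> rfl

theorem qChoose_succ_succ (ω : k) (n i : ℕ) :
    qChoose ω (n + 1) (i + 1) = qChoose ω n i + ω ^ (i + 1) * qChoose ω n (i + 1) := rfl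

theorem qChoose_absorb (ω : k) (n : ℕ) : ∀ i,
    (ω ^ (i + 1) - 1) * qChoose ω (n + 1) (i + 1) = (ω ^ (n + 1) - 1) * qChoose ω n i := by
  induction n with
  | zero =>
    intro i
    cases i with
    | zero => simp [qChoose]
    | succ i => simp [qChoose]
  | succ m ih =>
    intro i
    cases i with
    | zero =>
      have h := ih 0
      rw [qChoose_zero_right] at h
      rw [qChoose_succ_succ, qChoose_zero_right]
      linear_combination ω * h
    | succ j =>
      have h1 := ih (j + 1)
      have h2 := ih j
      have h3 := qChoose_succ_succ ω m j
      rw [qChoose_succ_succ ω (m + 1) (j + 1)]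
      linear_combination ω ^ (j + 2) * h1 - ω * (ω ^ (m + 1) - 1) * h3 + ω * h2

theorem qChoose_eq_zero_of_lt (ω : k) : ∀ n i, n < i → qChoose ω n i = 0
  | _, 0, h => by omega
  | 0, _ + 1, _ => rfl
  | n + 1, i + 1, h => by
    rw [qChoose_succ_succ, qChoose_eq_zero_of_lt ω n i (by omega),
      qChoose_eq_zero_of_lt ω n (i + 1) (by omega)]
    simp

theorem qChoose_self (ω : k) : ∀ n, qChoose ω n n = 1
  | 0 => rfl
  | n + 1 => by
    rw [qChoose_succ_succ, qChoose_self ω n, qChoose_eq_zero_of_lt ω n (n + 1) (by omega)]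
    simp

variable {A : Type*} [Ring A] [Algebra k A]

theorem qcomm_pow_right {ω : k} {x y : A} (h : y * x = ω • (x * y)) (i : ℕ) :
    y * x ^ i = ω ^ i • (x ^ i * y) := by
  induction i with
  | zero => simp
  | succ i ih =>
    rw [pow_succ, ← mul_assoc, ih, smul_mul_assoc, mul_assoc, h, mul_smul_comm, smul_smul,
      ← mul_assoc, ← pow_succ, ← pow_succ]

theorem qcomm_pow_left {ω : k} {x y : A} (h : y * x = ω • (x * y)) (i : ℕ) :
    y ^ i * x = ω ^ i • (x * y ^ i) := by
  induction i with
  | zero => simp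
  | succ i ih =>
    rw [pow_succ', mul_assoc, ih, mul_smul_comm, ← mul_assoc, h, smul_mul_assoc, smul_smul,
      mul_assoc, pow_succ]

theorem qcomm_add_pow {ω : k} {x y : A} (h : y * x = ω • (x * y)) (n : ℕ) :
    (x + y) ^ n = ∑ i ∈ Finset.range (n + 1), qChoose ω n i • (x ^ i * y ^ (n - i)) := by
  induction n with
  | zero => simp [qChoose]
  | succ n ih =>
    rw [pow_succ', ih, add_mul, Finset.mul_sum, Finset.mul_sum,
      Finset.sum_range_succ' _ (n + 1)]
    have e1 : ∑ i ∈ Finset.range (n + 1), x * qChoose ω n i • (x ^ i * y ^ (n - i)) =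
        ∑ i ∈ Finset.range (n + 1), qChoose ω n i • (x ^ (i + 1) * y ^ (n - i)) := by
      refine Finset.sum_congr rfl fun i _ => ?_
      rw [mul_smul_comm, ← mul_assoc, ← pow_succ']
    have e2 : ∑ i ∈ Finset.range (n + 1), y * qChoose ω n i • (x ^ i * y ^ (n - i)) =
        ∑ i ∈ Finset.range (n + 2),
          (ω ^ i * qChoose ω n i) • (x ^ i * y ^ (n + 1 - i)) := by
      rw [Finset.sum_range_succ _ (n + 1), qChoose_eq_zero_of_lt ω n (n + 1) (by omega)]
      simp only [mul_zero, zero_smul, add_zero]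
      refine Finset.sum_congr rfl fun i hi => ?_
      have hi' : i ≤ n := by simpa [Nat.lt_succ_iff] using hi
      rw [mul_smul_comm, ← mul_assoc, qcomm_pow_right h, smul_mul_assoc, smul_smul, mul_assoc,
        ← pow_succ', mul_comm, Nat.succ_sub hi']
    rw [e1, e2, Finset.sum_range_succ' _ (n + 1), ← add_assoc, ← Finset.sum_add_distrib]
    congr 1
    · refine Finset.sum_congr rfl fun i _ => ?_
      rw [qChoose_succ_succ, add_smul, Nat.add_sub_add_right]
    · simp [qChoose_zero_right]

theorem qcomm_add_pow_order {ω : k} {N : ℕ} (hω : IsPrimitiveRoot ω N) (hN : 0 < N) {x y : A}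
    (h : y * x = ω • (x * y)) : (x + y) ^ N = x ^ N + y ^ N := by
  obtain ⟨M, rfl⟩ : ∃ M, N = M + 1 := ⟨N - 1, by omega⟩
  rw [qcomm_add_pow h, Finset.sum_range_succ, Finset.sum_range_succ', Finset.sum_eq_zero]
  · simp [qChoose_zero_right, qChoose_self, add_comm]
  · intro i hi
    have hi' : i < M := by simpa using hi
    have h0 : ω ^ (i + 1) - 1 ≠ 0 :=
      sub_ne_zero.mpr (hω.pow_ne_one_of_pos_of_lt (by omega) (by omega))
    have := qChoose_absorb ω M i
    rw [hω.pow_eq_one, sub_self, zero_mul] at this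
    rw [(mul_eq_zero.mp this).resolve_left h0, zero_smul]

theorem pow_mod_of_pow_eq_one {N : ℕ} {g : A} (h : g ^ N = 1) (j : ℕ) : g ^ (j % N) = g ^ j := by
  conv_rhs => rw [← Nat.div_add_mod j N, pow_add, pow_mul, h, one_pow, one_mul]

theorem span_eq_top_of_mul_mem {s : Set A} (hs : Algebra.adjoin k s = ⊤) {W : Submodule k A}
    (h1 : (1 : A) ∈ W) (hmul : ∀ a ∈ s, ∀ w ∈ W, w * a ∈ W) : W = ⊤ := by
  rw [eq_top_iff]
  intro a _
  have ha : a ∈ Algebra.adjoin k s := by rw [hs]; trivial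
  have key : ∀ w ∈ W, w * a ∈ W := by
    induction ha using Algebra.adjoin_induction with
    | mem x hx => exact hmul x hx
    | algebraMap r =>
      intro w hw
      rw [← Algebra.commutes, ← Algebra.smul_def]
      exact W.smul_mem _ hw
    | add x y _ _ hx hy => intro w hw; rw [mul_add]; exact W.add_mem (hx trivial w hw) (hy trivial w hw)
    | mul x y _ _ hx hy => intro w hw; rw [← mul_assoc]; exact hy trivial _ (hx trivial w hw)
  simpa using key 1 h1

theorem qcomm_mul_pow {ω : k} {x y : A} (h : y * x = ω • (x * y)) (n : ℕ) :
    ∃ c : k, (x * y) ^ n = c • (x ^ n * y ^ n) := by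
  induction n with
  | zero => exact ⟨1, by simp⟩
  | succ n ih =>
    obtain ⟨c, hc⟩ := ih
    refine ⟨c * ω ^ n, ?_⟩
    rw [pow_succ, hc, smul_mul_assoc, mul_assoc, ← mul_assoc (y ^ n), qcomm_pow_left h,
      smul_mul_assoc, mul_smul_comm, smul_smul, pow_succ, pow_succ]
    simp only [mul_assoc]

end QComm

/-! ### A criterion for the antipode axioms -/

section Antipode

open Coalgebra

variable {k A : Type*} [Field k] [Ring A] [Bialgebra k A]

theorem antipode_left_of_adjoin (S : A →ₐ[k] Aᵐᵒᵖ) (s : Set A) (hs : Algebra.adjoin k s = ⊤)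
    (T : A →ₗ[k] A) (hT : T = (MulOpposite.opLinearEquiv k).symm.toLinearMap ∘ₗ S.toLinearMap)
    (h : ∀ a ∈ s, LinearMap.mul' k A (T.rTensor A (comul a)) = algebraMap k A (counit a)) :
    LinearMap.mul' k A ∘ₗ T.rTensor A ∘ₗ comul = Algebra.linearMap k A ∘ₗ counit := by
  have T1 : T 1 = 1 := by simp [hT]
  have Tm : ∀ a b, T (a * b) = T b * T a := by intro a b; simp [hT]
  ext a
  simp only [LinearMap.comp_apply, Algebra.linearMap_apply]
  have ha : a ∈ Algebra.adjoin k s := by rw [hs]; trivial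
  induction ha using Algebra.adjoin_induction with
  | mem x hx => exact h x hx
  | algebraMap r =>
    rw [Algebra.algebraMap_eq_smul_one]
    simp [Algebra.TensorProduct.one_def, T1, Algebra.algebraMap_eq_smul_one]
  | add x y _ _ hx hy => simp only [map_add, hx, hy]
  | mul x y _ _ hx hy =>
    have e : LinearMap.mul' k A (T.rTensor A (comul (x * y))) =
        counit (R := k) x • LinearMap.mul' k A (T.rTensor A (comul y)) := by
      rw [Bialgebra.comul_mul]
      generalize (comul y : A ⊗[k] A) = v
      induction v using TensorProduct.induction_on with
      | zero => simp
      | add v w hv hw => simp only [mul_add, map_add, hv, hw, smul_add]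
      | tmul p r =>
        have e2 : ∀ u : A ⊗[k] A, LinearMap.mul' k A (T.rTensor A (u * p ⊗ₜ r)) =
            T p * LinearMap.mul' k A (T.rTensor A u) * r := by
          intro u
          induction u using TensorProduct.induction_on with
          | zero => simp
          | add v w hv hw => simp only [add_mul, mul_add, map_add, hv, hw]
          | tmul a b => simp [Tm, mul_assoc]
        rw [e2, hx, Algebra.algebraMap_eq_smul_one]
        simp
    rw [e, hy, Bialgebra.counit_mul, Algebra.smul_def, map_mul]

theorem antipode_right_of_adjoin (S : A →ₐ[k] Aᵐᵒᵖ) (s : Set A) (hs : Algebra.adjoin k s = ⊤)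
    (T : A →ₗ[k] A) (hT : T = (MulOpposite.opLinearEquiv k).symm.toLinearMap ∘ₗ S.toLinearMap)
    (h : ∀ a ∈ s, LinearMap.mul' k A (T.lTensor A (comul a)) = algebraMap k A (counit a)) :
    LinearMap.mul' k A ∘ₗ T.lTensor A ∘ₗ comul = Algebra.linearMap k A ∘ₗ counit := by
  have T1 : T 1 = 1 := by simp [hT]
  have Tm : ∀ a b, T (a * b) = T b * T a := by intro a b; simp [hT]
  ext a
  simp only [LinearMap.comp_apply, Algebra.linearMap_apply]
  have ha : a ∈ Algebra.adjoin k s := by rw [hs]; trivial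
  induction ha using Algebra.adjoin_induction with
  | mem x hx => exact h x hx
  | algebraMap r =>
    rw [Algebra.algebraMap_eq_smul_one]
    simp [Algebra.TensorProduct.one_def, T1, Algebra.algebraMap_eq_smul_one]
  | add x y _ _ hx hy => simp only [map_add, hx, hy]
  | mul x y _ _ hx hy =>
    have e : LinearMap.mul' k A (T.lTensor A (comul (x * y))) =
        counit (R := k) y • LinearMap.mul' k A (T.lTensor A (comul x)) := by
      rw [Bialgebra.comul_mul]
      generalize (comul x : A ⊗[k] A) = v
      induction v using TensorProduct.induction_on with
      | zero => simp
      | add v w hv hw => simp only [add_mul, map_add, hv, hw, smul_add]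
      | tmul p r =>
        have e2 : ∀ u : A ⊗[k] A, LinearMap.mul' k A (T.lTensor A (p ⊗ₜ r * u)) =
            p * LinearMap.mul' k A (T.lTensor A u) * T r := by
          intro u
          induction u using TensorProduct.induction_on with
          | zero => simp
          | add v w hv hw => simp only [add_mul, mul_add, map_add, hv, hw]
          | tmul a b => simp [Tm, mul_assoc]
        rw [e2, hy, Algebra.algebraMap_eq_smul_one]
        simp
    rw [e, hx, Bialgebra.counit_mul, Algebra.smul_def, map_mul, ← map_mul, mul_comm, map_mul]

end Antipode

/-! ### The Taft algebra -/

section Taft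

variable {k : Type*} [Field k]

/-- Names of the generators of the Taft algebra. -/
inductive TaftGen : Type
  | x
  | g

/-- The relations `x ^ N = 0`, `g ^ N = 1`, `g x = ω x g`. -/
inductive TaftRel (ω : k) (N : ℕ) : FreeAlgebra k TaftGen → FreeAlgebra k TaftGen → Prop
  | x_pow : TaftRel ω N (FreeAlgebra.ι k TaftGen.x ^ N) 0
  | g_pow : TaftRel ω N (FreeAlgebra.ι k TaftGen.g ^ N) 1
  | g_mul_x : TaftRel ω N (FreeAlgebra.ι k TaftGen.g * FreeAlgebra.ι k TaftGen.x)
      (ω • (FreeAlgebra.ι k TaftGen.x * FreeAlgebra.ι k TaftGen.g))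

/-- The Taft algebra `T_{N²}(ω)`, for `ω` a primitive `N`-th root of unity, `N > 1`: the `k`-algebra
presented by generators `x`, `g` and the relations `TaftRel`. -/
def TaftAlgebra {ω : k} {N : ℕ} (_hω : IsPrimitiveRoot ω N) (_hN : 1 < N) : Type _ :=
  RingQuot (TaftRel ω N)

namespace TaftAlgebra

variable {ω : k} {N : ℕ} (hω : IsPrimitiveRoot ω N) (hN : 1 < N)

instance : Ring (TaftAlgebra hω hN) := inferInstanceAs (Ring (RingQuot (TaftRel ω N)))

instance : Algebra k (TaftAlgebra hω hN) := inferInstanceAs (Algebra k (RingQuot (TaftRel ω N)))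

/-- The quotient map from the free algebra. -/
def mk : FreeAlgebra k TaftGen →ₐ[k] TaftAlgebra hω hN := RingQuot.mkAlgHom k (TaftRel ω N)

/-- The generator `x`. -/
def x : TaftAlgebra hω hN := mk hω hN (FreeAlgebra.ι k TaftGen.x)

/-- The generator `g`. -/
def g : TaftAlgebra hω hN := mk hω hN (FreeAlgebra.ι k TaftGen.g)

theorem mk_surjective : Function.Surjective (mk hω hN) := RingQuot.mkAlgHom_surjective k _

theorem x_pow : x hω hN ^ N = 0 := by
  have := RingQuot.mkAlgHom_rel k (TaftRel.x_pow (ω := ω) (N := N))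
  rw [map_pow, map_zero] at this
  exact this

theorem g_pow : g hω hN ^ N = 1 := by
  have := RingQuot.mkAlgHom_rel k (TaftRel.g_pow (ω := ω) (N := N))
  rw [map_pow, map_one] at this
  exact this

theorem g_mul_x : g hω hN * x hω hN = ω • (x hω hN * g hω hN) := by
  have := RingQuot.mkAlgHom_rel k (TaftRel.g_mul_x (ω := ω) (N := N))
  rw [map_mul, map_smul, map_mul] at this
  exact this

theorem adjoin_eq_top : Algebra.adjoin k {x hω hN, g hω hN} = ⊤ := by
  have h := congrArg (Subalgebra.map (mk hω hN)) (FreeAlgebra.adjoin_range_ι k TaftGen)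
  rw [AlgHom.map_adjoin, Algebra.map_top, (AlgHom.range_eq_top _).mpr (mk_surjective hω hN)] at h
  rw [← h]
  congr 1
  ext a
  constructor
  · rintro (rfl | rfl)
    · exact ⟨_, ⟨TaftGen.x, rfl⟩, rfl⟩
    · exact ⟨_, ⟨TaftGen.g, rfl⟩, rfl⟩
  · rintro ⟨_, ⟨i, rfl⟩, rfl⟩
    cases i
    · exact Or.inl rfl
    · exact Or.inr rfl

section Lift

variable {B : Type*} [Ring B] [Algebra k B]

/-- The universal property of the presentation. -/
def lift (X G : B) (hX : X ^ N = 0) (hG : G ^ N = 1) (hGX : G * X = ω • (X * G)) :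
    TaftAlgebra hω hN →ₐ[k] B :=
  RingQuot.liftAlgHom k ⟨FreeAlgebra.lift k (fun | TaftGen.x => X | TaftGen.g => G), by
    intro a b hab
    cases hab <;> simp [hX, hG, hGX]⟩

variable (X G : B) (hX : X ^ N = 0) (hG : G ^ N = 1) (hGX : G * X = ω • (X * G))

@[simp]
theorem lift_x : lift hω hN X G hX hG hGX (x hω hN) = X := by
  refine (RingQuot.liftAlgHom_mkAlgHom_apply k _ _ _).trans ?_
  simp

@[simp]
theorem lift_g : lift hω hN X G hX hG hGX (g hω hN) = G := by
  refine (RingQuot.liftAlgHom_mkAlgHom_apply k _ _ _).trans ?_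
  simp

variable {hω hN} in
theorem hom_ext {φ ψ : TaftAlgebra hω hN →ₐ[k] B} (hx : φ (x hω hN) = ψ (x hω hN))
    (hg : φ (g hω hN) = ψ (g hω hN)) : φ = ψ := by
  refine AlgHom.ext_of_adjoin_eq_top (adjoin_eq_top hω hN) ?_
  rintro a (rfl | rfl)
  · exact hx
  · exact hg

end Lift

/-- The inverse `g ^ (N - 1)` of `g`. -/
def gInv : TaftAlgebra hω hN := g hω hN ^ (N - 1)

theorem g_mul_gInv : g hω hN * gInv hω hN = 1 := by
  rw [gInv, ← pow_succ', Nat.sub_add_cancel (by omega), g_pow]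

theorem gInv_mul_g : gInv hω hN * g hω hN = 1 := by
  rw [gInv, ← pow_succ, Nat.sub_add_cancel (by omega), g_pow]

theorem gInv_pow : gInv hω hN ^ N = 1 := by
  rw [gInv, ← pow_mul, mul_comm, pow_mul, g_pow, one_pow]

theorem x_mul_gInv : x hω hN * gInv hω hN = ω • (gInv hω hN * x hω hN) := by
  have h := congrArg (fun t => gInv hω hN * t * gInv hω hN) (g_mul_x hω hN)
  simp only [mul_smul_comm, smul_mul_assoc] at h
  rw [← mul_assoc, gInv_mul_g, one_mul, ← mul_assoc, mul_assoc _ (g hω hN), g_mul_gInv,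
    mul_one] at h
  exact h

/-- `Δ(x) = x ⊗ 1 + g ⊗ x`, `Δ(g) = g ⊗ g`. -/
def comulHom : TaftAlgebra hω hN →ₐ[k] TaftAlgebra hω hN ⊗[k] TaftAlgebra hω hN :=
  lift hω hN (x hω hN ⊗ₜ 1 + g hω hN ⊗ₜ x hω hN) (g hω hN ⊗ₜ g hω hN)
    (by
      rw [qcomm_add_pow_order hω (by omega)]
      · simp [Algebra.TensorProduct.tmul_pow, x_pow]
      · simp [g_mul_x, TensorProduct.smul_tmul'])
    (by simp [Algebra.TensorProduct.tmul_pow, g_pow, Algebra.TensorProduct.one_def])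
    (by
      simp only [mul_add, add_mul, Algebra.TensorProduct.tmul_mul_tmul, mul_one, one_mul, g_mul_x,
        smul_add, TensorProduct.smul_tmul', TensorProduct.tmul_smul])

/-- `ε(x) = 0`, `ε(g) = 1`. -/
def counitHom : TaftAlgebra hω hN →ₐ[k] k :=
  lift hω hN 0 1 (zero_pow (by omega)) (one_pow _) (by simp)

/-- `S(x) = -g⁻¹ x`, `S(g) = g⁻¹`, extended to an algebra anti-homomorphism. -/
def antipodeHom : TaftAlgebra hω hN →ₐ[k] (TaftAlgebra hω hN)ᵐᵒᵖ :=
  lift hω hN (MulOpposite.op (-(gInv hω hN * x hω hN))) (MulOpposite.op (gInv hω hN))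
    (by
      obtain ⟨c, hc⟩ := qcomm_mul_pow (x_mul_gInv hω hN) N
      rw [← MulOpposite.op_pow, neg_pow, hc, x_pow]
      simp)
    (by rw [← MulOpposite.op_pow, gInv_pow, MulOpposite.op_one])
    (by
      rw [← MulOpposite.op_mul, ← MulOpposite.op_mul, ← MulOpposite.op_smul]
      simp only [neg_mul, mul_neg, smul_neg, mul_assoc, x_mul_gInv, mul_smul_comm])

instance : Bialgebra k (TaftAlgebra hω hN) :=
  Bialgebra.ofAlgHom (comulHom hω hN) (counitHom hω hN)
    (by
      apply hom_ext <;>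
        simp [comulHom, TensorProduct.add_tmul, TensorProduct.tmul_add,
          Algebra.TensorProduct.one_def, add_assoc])
    (by apply hom_ext <;> simp [comulHom, counitHom])
    (by apply hom_ext <;> simp [comulHom, counitHom])

theorem comul_x : Coalgebra.comul (R := k) (x hω hN) = x hω hN ⊗ₜ 1 + g hω hN ⊗ₜ x hω hN :=
  lift_x ..

theorem comul_g : Coalgebra.comul (R := k) (g hω hN) = g hω hN ⊗ₜ g hω hN := lift_g ..

theorem counit_x : Coalgebra.counit (R := k) (x hω hN) = 0 := lift_x ..

theorem counit_g : Coalgebra.counit (R := k) (g hω hN) = 1 := lift_g ..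

/-- The antipode as a linear map. -/
def antipodeLin : TaftAlgebra hω hN →ₗ[k] TaftAlgebra hω hN :=
  (MulOpposite.opLinearEquiv k).symm.toLinearMap ∘ₗ (antipodeHom hω hN).toLinearMap

theorem antipodeLin_x : antipodeLin hω hN (x hω hN) = -(gInv hω hN * x hω hN) := by
  simp [antipodeLin, antipodeHom]

theorem antipodeLin_g : antipodeLin hω hN (g hω hN) = gInv hω hN := by
  simp [antipodeLin, antipodeHom]

theorem antipodeLin_one : antipodeLin hω hN 1 = 1 := by
  simp [antipodeLin]

instance : HopfAlgebra k (TaftAlgebra hω hN) where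
  antipode := antipodeLin hω hN
  mul_antipode_rTensor_comul :=
    antipode_left_of_adjoin (antipodeHom hω hN) _ (adjoin_eq_top hω hN) _ rfl (by
      rintro a (rfl | rfl)
      · simp [comul_x, counit_x, antipodeLin_x, antipodeLin_g]
      · simp [comul_g, counit_g, antipodeLin_g, gInv_mul_g])
  mul_antipode_lTensor_comul :=
    antipode_right_of_adjoin (antipodeHom hω hN) _ (adjoin_eq_top hω hN) _ rfl (by
      rintro a (rfl | rfl)
      · simp [comul_x, counit_x, antipodeLin_x, antipodeLin_one, ← mul_assoc, g_mul_gInv]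
      · simp [comul_g, counit_g, antipodeLin_g, g_mul_gInv])

theorem antipode_x : HopfAlgebra.antipode k (x hω hN) = -(gInv hω hN * x hω hN) :=
  antipodeLin_x hω hN

theorem antipode_g : HopfAlgebra.antipode k (g hω hN) = gInv hω hN := antipodeLin_g hω hN

/-- The monomials `x ^ i g ^ j`, `i, j < N`, span the Taft algebra. -/
theorem span_monomials :
    Submodule.span k (Set.range fun p : Fin N × Fin N =>
      x hω hN ^ (p.1 : ℕ) * g hω hN ^ (p.2 : ℕ)) = ⊤ := by
  set W := Submodule.span k (Set.range fun p : Fin N × Fin N =>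
      x hω hN ^ (p.1 : ℕ) * g hω hN ^ (p.2 : ℕ)) with hW
  have hmem : ∀ i j : ℕ, x hω hN ^ i * g hω hN ^ j ∈ W := by
    intro i j
    by_cases hi : i < N
    · rw [← pow_mod_of_pow_eq_one (g_pow hω hN) j]
      exact Submodule.subset_span ⟨(⟨i, hi⟩, ⟨j % N, Nat.mod_lt _ (by omega)⟩), rfl⟩
    · rw [pow_eq_zero_of_le (not_lt.mp hi) (x_pow hω hN), zero_mul]
      exact W.zero_mem
  refine span_eq_top_of_mul_mem (adjoin_eq_top hω hN) ?_ ?_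
  · simpa using hmem 0 0
  · rintro a (rfl | rfl) w hw <;> rw [hW] at hw <;>
      induction hw using Submodule.span_induction with
      | mem _ h =>
        obtain ⟨⟨i, j⟩, rfl⟩ := h
        first
        | rw [mul_assoc, qcomm_pow_left (g_mul_x hω hN), mul_smul_comm, ← mul_assoc, ← pow_succ]
          exact W.smul_mem _ (hmem _ _)
        | rw [mul_assoc, ← pow_succ]
          exact hmem _ _
      | zero => rw [zero_mul]; exact W.zero_mem
      | add u v _ _ hu hv => rw [add_mul]; exact W.add_mem hu hv
      | smul c u _ hu => rw [smul_mul_assoc]; exact W.smul_mem _ hu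

instance : Module.Finite k (TaftAlgebra hω hN) :=
  ⟨Submodule.fg_def.mpr ⟨_, Set.finite_range _, span_monomials hω hN⟩⟩

end TaftAlgebra

end Taft

/-! ### The small quantum group `u_q(sl₂)` -/

section SmallQuantumGroup

variable {k : Type*} [Field k]

/-- Names of the generators of `u_q(sl₂)`. -/
inductive UqGen : Type
  | E
  | F
  | K

/-- The relations `E ^ N = F ^ N = 0`, `K ^ N = 1`, `K E = q² E K`, `K F = q⁻² F K`,
`E F - F E = (K - K ^ (N - 1)) / (q - q⁻¹)`. -/
inductive UqRel (q : k) (N : ℕ) : FreeAlgebra k UqGen → FreeAlgebra k UqGen → Prop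
  | E_pow : UqRel q N (FreeAlgebra.ι k UqGen.E ^ N) 0
  | F_pow : UqRel q N (FreeAlgebra.ι k UqGen.F ^ N) 0
  | K_pow : UqRel q N (FreeAlgebra.ι k UqGen.K ^ N) 1
  | K_mul_E : UqRel q N (FreeAlgebra.ι k UqGen.K * FreeAlgebra.ι k UqGen.E)
      (q ^ 2 • (FreeAlgebra.ι k UqGen.E * FreeAlgebra.ι k UqGen.K))
  | K_mul_F : UqRel q N (FreeAlgebra.ι k UqGen.K * FreeAlgebra.ι k UqGen.F)
      ((q ^ 2)⁻¹ • (FreeAlgebra.ι k UqGen.F * FreeAlgebra.ι k UqGen.K))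
  | E_F : UqRel q N
      (FreeAlgebra.ι k UqGen.E * FreeAlgebra.ι k UqGen.F -
        FreeAlgebra.ι k UqGen.F * FreeAlgebra.ι k UqGen.E)
      ((q - q⁻¹)⁻¹ • (FreeAlgebra.ι k UqGen.K - FreeAlgebra.ι k UqGen.K ^ (N - 1)))

/-- The small quantum group `u_q(sl₂)`, for `q` a root of unity of odd order `N > 1`: the
`k`-algebra presented by generators `E`, `F`, `K` and the relations `UqRel`. -/
def SmallUqSl2 {q : k} {N : ℕ} (_hq : IsPrimitiveRoot q N) (_hodd : Odd N) (_hN : 1 < N) : Type _ :=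
  RingQuot (UqRel q N)

theorem isPrimitiveRoot_sq {q : k} {N : ℕ} (hq : IsPrimitiveRoot q N) (hodd : Odd N) :
    IsPrimitiveRoot (q ^ 2) N :=
  hq.pow_of_coprime 2 (Nat.coprime_two_left.mpr hodd)

namespace SmallUqSl2

variable {q : k} {N : ℕ} (hq : IsPrimitiveRoot q N) (hodd : Odd N) (hN : 1 < N)

instance : Ring (SmallUqSl2 hq hodd hN) := inferInstanceAs (Ring (RingQuot (UqRel q N)))

instance : Algebra k (SmallUqSl2 hq hodd hN) := inferInstanceAs (Algebra k (RingQuot (UqRel q N)))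

/-- The quotient map from the free algebra. -/
def mk : FreeAlgebra k UqGen →ₐ[k] SmallUqSl2 hq hodd hN := RingQuot.mkAlgHom k (UqRel q N)

/-- The generator `E`. -/
def E : SmallUqSl2 hq hodd hN := mk hq hodd hN (FreeAlgebra.ι k UqGen.E)

/-- The generator `F`. -/
def F : SmallUqSl2 hq hodd hN := mk hq hodd hN (FreeAlgebra.ι k UqGen.F)

/-- The generator `K`. -/
def K : SmallUqSl2 hq hodd hN := mk hq hodd hN (FreeAlgebra.ι k UqGen.K)

/-- The inverse `K ^ (N - 1)` of `K`. -/
def KInv : SmallUqSl2 hq hodd hN := K hq hodd hN ^ (N - 1)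

theorem mk_surjective : Function.Surjective (mk hq hodd hN) := RingQuot.mkAlgHom_surjective k _

theorem E_pow : E hq hodd hN ^ N = 0 := by
  have := RingQuot.mkAlgHom_rel k (UqRel.E_pow (q := q) (N := N))
  rw [map_pow, map_zero] at this
  exact this

theorem F_pow : F hq hodd hN ^ N = 0 := by
  have := RingQuot.mkAlgHom_rel k (UqRel.F_pow (q := q) (N := N))
  rw [map_pow, map_zero] at this
  exact this

theorem K_pow : K hq hodd hN ^ N = 1 := by
  have := RingQuot.mkAlgHom_rel k (UqRel.K_pow (q := q) (N := N))
  rw [map_pow, map_one] at this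
  exact this

theorem K_mul_E : K hq hodd hN * E hq hodd hN = q ^ 2 • (E hq hodd hN * K hq hodd hN) := by
  have := RingQuot.mkAlgHom_rel k (UqRel.K_mul_E (q := q) (N := N))
  rw [map_mul, map_smul, map_mul] at this
  exact this

theorem K_mul_F : K hq hodd hN * F hq hodd hN = (q ^ 2)⁻¹ • (F hq hodd hN * K hq hodd hN) := by
  have := RingQuot.mkAlgHom_rel k (UqRel.K_mul_F (q := q) (N := N))
  rw [map_mul, map_smul, map_mul] at this
  exact this

theorem E_F : E hq hodd hN * F hq hodd hN - F hq hodd hN * E hq hodd hN =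
    (q - q⁻¹)⁻¹ • (K hq hodd hN - KInv hq hodd hN) := by
  have := RingQuot.mkAlgHom_rel k (UqRel.E_F (q := q) (N := N))
  rw [map_sub, map_mul, map_mul, map_smul, map_sub, map_pow] at this
  exact this

theorem adjoin_eq_top :
    Algebra.adjoin k {E hq hodd hN, F hq hodd hN, K hq hodd hN} = ⊤ := by
  have h := congrArg (Subalgebra.map (mk hq hodd hN)) (FreeAlgebra.adjoin_range_ι k UqGen)
  rw [AlgHom.map_adjoin, Algebra.map_top,
    (AlgHom.range_eq_top _).mpr (mk_surjective hq hodd hN)] at h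
  rw [← h]
  congr 1
  ext a
  constructor
  · rintro (rfl | rfl | rfl)
    · exact ⟨_, ⟨UqGen.E, rfl⟩, rfl⟩
    · exact ⟨_, ⟨UqGen.F, rfl⟩, rfl⟩
    · exact ⟨_, ⟨UqGen.K, rfl⟩, rfl⟩
  · rintro ⟨_, ⟨i, rfl⟩, rfl⟩
    cases i
    · exact Or.inl rfl
    · exact Or.inr (Or.inl rfl)
    · exact Or.inr (Or.inr rfl)

section Lift

variable {B : Type*} [Ring B] [Algebra k B]

/-- The universal property of the presentation. -/
def lift (X Y Z : B) (hX : X ^ N = 0) (hY : Y ^ N = 0) (hZ : Z ^ N = 1)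
    (hZX : Z * X = q ^ 2 • (X * Z)) (hZY : Z * Y = (q ^ 2)⁻¹ • (Y * Z))
    (hXY : X * Y - Y * X = (q - q⁻¹)⁻¹ • (Z - Z ^ (N - 1))) :
    SmallUqSl2 hq hodd hN →ₐ[k] B :=
  RingQuot.liftAlgHom k
    ⟨FreeAlgebra.lift k (fun | UqGen.E => X | UqGen.F => Y | UqGen.K => Z), by
      intro a b hab
      cases hab with
      | E_pow => simp [hX]
      | F_pow => simp [hY]
      | K_pow => simp [hZ]
      | K_mul_E => simpa using hZX
      | K_mul_F => simpa using hZY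
      | E_F => simpa using hXY⟩

variable (X Y Z : B) (hX : X ^ N = 0) (hY : Y ^ N = 0) (hZ : Z ^ N = 1)
    (hZX : Z * X = q ^ 2 • (X * Z)) (hZY : Z * Y = (q ^ 2)⁻¹ • (Y * Z))
    (hXY : X * Y - Y * X = (q - q⁻¹)⁻¹ • (Z - Z ^ (N - 1)))

@[simp]
theorem lift_E : lift hq hodd hN X Y Z hX hY hZ hZX hZY hXY (E hq hodd hN) = X := by
  refine (RingQuot.liftAlgHom_mkAlgHom_apply k _ _ _).trans ?_
  simp

@[simp]
theorem lift_F : lift hq hodd hN X Y Z hX hY hZ hZX hZY hXY (F hq hodd hN) = Y := by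
  refine (RingQuot.liftAlgHom_mkAlgHom_apply k _ _ _).trans ?_
  simp

@[simp]
theorem lift_K : lift hq hodd hN X Y Z hX hY hZ hZX hZY hXY (K hq hodd hN) = Z := by
  refine (RingQuot.liftAlgHom_mkAlgHom_apply k _ _ _).trans ?_
  simp

variable {hq hodd hN} in
theorem hom_ext {φ ψ : SmallUqSl2 hq hodd hN →ₐ[k] B}
    (hE : φ (E hq hodd hN) = ψ (E hq hodd hN)) (hF : φ (F hq hodd hN) = ψ (F hq hodd hN))
    (hK : φ (K hq hodd hN) = ψ (K hq hodd hN)) : φ = ψ := by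
  refine AlgHom.ext_of_adjoin_eq_top (adjoin_eq_top hq hodd hN) ?_
  rintro a (rfl | rfl | rfl)
  · exact hE
  · exact hF
  · exact hK

end Lift

theorem K_mul_KInv : K hq hodd hN * KInv hq hodd hN = 1 := by
  rw [KInv, ← pow_succ', Nat.sub_add_cancel (by omega), K_pow]

theorem KInv_mul_K : KInv hq hodd hN * K hq hodd hN = 1 := by
  rw [KInv, ← pow_succ, Nat.sub_add_cancel (by omega), K_pow]

theorem KInv_pow : KInv hq hodd hN ^ N = 1 := by
  rw [KInv, ← pow_mul, mul_comm, pow_mul, K_pow, one_pow]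

theorem KInv_pow_pred : KInv hq hodd hN ^ (N - 1) = K hq hodd hN := by
  have h : KInv hq hodd hN ^ (N - 1) * KInv hq hodd hN = 1 := by
    rw [← pow_succ, Nat.sub_add_cancel (by omega), KInv_pow]
  calc KInv hq hodd hN ^ (N - 1)
      = KInv hq hodd hN ^ (N - 1) * (KInv hq hodd hN * K hq hodd hN) := by
        rw [KInv_mul_K, mul_one]
    _ = K hq hodd hN := by rw [← mul_assoc, h, one_mul]

theorem E_mul_KInv :
    E hq hodd hN * KInv hq hodd hN = q ^ 2 • (KInv hq hodd hN * E hq hodd hN) := by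
  have h := congrArg (fun t => KInv hq hodd hN * t * KInv hq hodd hN) (K_mul_E hq hodd hN)
  simp only [mul_smul_comm, smul_mul_assoc] at h
  rw [← mul_assoc, KInv_mul_K, one_mul, ← mul_assoc, mul_assoc _ (K hq hodd hN), K_mul_KInv,
    mul_one] at h
  exact h

theorem F_mul_KInv :
    F hq hodd hN * KInv hq hodd hN = (q ^ 2)⁻¹ • (KInv hq hodd hN * F hq hodd hN) := by
  have h := congrArg (fun t => KInv hq hodd hN * t * KInv hq hodd hN) (K_mul_F hq hodd hN)
  simp only [mul_smul_comm, smul_mul_assoc] at h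
  rw [← mul_assoc, KInv_mul_K, one_mul, ← mul_assoc, mul_assoc _ (K hq hodd hN), K_mul_KInv,
    mul_one] at h
  exact h

theorem sq_ne_zero {q : k} {N : ℕ} (hq : IsPrimitiveRoot q N) (hN : 1 < N) : q ^ 2 ≠ 0 := pow_ne_zero _ (hq.ne_zero (by omega))

theorem KInv_mul_E :
    KInv hq hodd hN * E hq hodd hN = (q ^ 2)⁻¹ • (E hq hodd hN * KInv hq hodd hN) := by
  rw [E_mul_KInv, inv_smul_smul₀ (sq_ne_zero hq hN)]

theorem KInv_mul_F :
    KInv hq hodd hN * F hq hodd hN = q ^ 2 • (F hq hodd hN * KInv hq hodd hN) := by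
  rw [F_mul_KInv, smul_inv_smul₀ (sq_ne_zero hq hN)]

/-- `Δ(E) = E ⊗ 1 + K ⊗ E`, `Δ(F) = F ⊗ K⁻¹ + 1 ⊗ F`, `Δ(K) = K ⊗ K`. -/
def comulHom : SmallUqSl2 hq hodd hN →ₐ[k] SmallUqSl2 hq hodd hN ⊗[k] SmallUqSl2 hq hodd hN :=
  lift hq hodd hN (E hq hodd hN ⊗ₜ 1 + K hq hodd hN ⊗ₜ E hq hodd hN)
    (F hq hodd hN ⊗ₜ KInv hq hodd hN + 1 ⊗ₜ F hq hodd hN) (K hq hodd hN ⊗ₜ K hq hodd hN)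
    (by
      rw [qcomm_add_pow_order (isPrimitiveRoot_sq hq hodd) (by omega)]
      · simp [Algebra.TensorProduct.tmul_pow, E_pow]
      · simp [K_mul_E, TensorProduct.smul_tmul'])
    (by
      rw [qcomm_add_pow_order (isPrimitiveRoot_sq hq hodd).inv (by omega)]
      · simp [Algebra.TensorProduct.tmul_pow, F_pow]
      · simp [F_mul_KInv])
    (by simp [Algebra.TensorProduct.tmul_pow, K_pow, Algebra.TensorProduct.one_def])
    (by
      simp only [mul_add, add_mul, Algebra.TensorProduct.tmul_mul_tmul, mul_one, one_mul, K_mul_E,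
        smul_add, TensorProduct.smul_tmul', TensorProduct.tmul_smul])
    (by
      have hc : K hq hodd hN * KInv hq hodd hN = KInv hq hodd hN * K hq hodd hN := by
        rw [K_mul_KInv, KInv_mul_K]
      simp only [mul_add, add_mul, Algebra.TensorProduct.tmul_mul_tmul, mul_one, one_mul, K_mul_F,
        smul_add, TensorProduct.smul_tmul', TensorProduct.tmul_smul, hc])
    (by
      have h1 : E hq hodd hN * F hq hodd hN = F hq hodd hN * E hq hodd hN +
          (q - q⁻¹)⁻¹ • (K hq hodd hN - KInv hq hodd hN) := by
        rw [← E_F]; abel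
      have hz := sq_ne_zero hq hN
      simp only [mul_add, add_mul, Algebra.TensorProduct.tmul_mul_tmul, mul_one, one_mul, h1,
        K_mul_F, E_mul_KInv, Algebra.TensorProduct.tmul_pow, TensorProduct.tmul_add,
        TensorProduct.add_tmul, ← TensorProduct.smul_tmul', TensorProduct.tmul_smul, smul_smul,
        TensorProduct.tmul_sub, TensorProduct.sub_tmul, smul_sub, mul_inv_cancel₀ hz,
        one_smul]
      rw [← KInv]
      abel)

/-- `ε(E) = ε(F) = 0`, `ε(K) = 1`. -/
def counitHom : SmallUqSl2 hq hodd hN →ₐ[k] k :=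
  lift hq hodd hN 0 0 1 (zero_pow (by omega)) (zero_pow (by omega)) (one_pow _) (by simp)
    (by simp) (by simp)

/-- `S(E) = -K⁻¹ E`, `S(F) = -F K`, `S(K) = K⁻¹`, extended to an algebra anti-homomorphism. -/
def antipodeHom : SmallUqSl2 hq hodd hN →ₐ[k] (SmallUqSl2 hq hodd hN)ᵐᵒᵖ :=
  lift hq hodd hN (MulOpposite.op (-(KInv hq hodd hN * E hq hodd hN)))
    (MulOpposite.op (-(F hq hodd hN * K hq hodd hN))) (MulOpposite.op (KInv hq hodd hN))
    (by
      obtain ⟨c, hc⟩ := qcomm_mul_pow (E_mul_KInv hq hodd hN) N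
      rw [← MulOpposite.op_pow, neg_pow, hc, E_pow]
      simp)
    (by
      obtain ⟨c, hc⟩ := qcomm_mul_pow (K_mul_F hq hodd hN) N
      rw [← MulOpposite.op_pow, neg_pow, hc, F_pow]
      simp)
    (by rw [← MulOpposite.op_pow, KInv_pow, MulOpposite.op_one])
    (by
      rw [← MulOpposite.op_mul, ← MulOpposite.op_mul, ← MulOpposite.op_smul]
      simp only [neg_mul, mul_neg, smul_neg, mul_assoc, E_mul_KInv, mul_smul_comm])
    (by
      rw [← MulOpposite.op_mul, ← MulOpposite.op_mul, ← MulOpposite.op_smul]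
      congr 1
      rw [neg_mul, mul_neg, smul_neg, ← mul_assoc, KInv_mul_F, smul_mul_assoc,
        inv_smul_smul₀ (sq_ne_zero hq hN), mul_assoc, mul_assoc, K_mul_KInv, KInv_mul_K])
    (by
      have h1 : E hq hodd hN * F hq hodd hN = F hq hodd hN * E hq hodd hN +
          (q - q⁻¹)⁻¹ • (K hq hodd hN - KInv hq hodd hN) := by
        rw [← E_F]; abel
      have hz := sq_ne_zero hq hN
      have e1 : F hq hodd hN * K hq hodd hN * (KInv hq hodd hN * E hq hodd hN) =
          F hq hodd hN * E hq hodd hN := by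
        rw [mul_assoc, ← mul_assoc (K hq hodd hN), K_mul_KInv, one_mul]
      have e2 : KInv hq hodd hN * E hq hodd hN * (F hq hodd hN * K hq hodd hN) =
          E hq hodd hN * F hq hodd hN := by
        rw [KInv_mul_E, smul_mul_assoc, mul_assoc, ← mul_assoc (KInv hq hodd hN), KInv_mul_F,
          smul_mul_assoc, mul_smul_comm, inv_smul_smul₀ hz, mul_assoc (F hq hodd hN), KInv_mul_K,
          mul_one]
      rw [← MulOpposite.op_pow, ← MulOpposite.op_mul, ← MulOpposite.op_mul, ← MulOpposite.op_sub,
        ← MulOpposite.op_sub, ← MulOpposite.op_smul, KInv_pow_pred]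
      congr 1
      rw [neg_mul_neg, neg_mul_neg, e1, e2, h1, ← neg_sub (K hq hodd hN), smul_neg]
      abel)

instance : Bialgebra k (SmallUqSl2 hq hodd hN) :=
  Bialgebra.ofAlgHom (comulHom hq hodd hN) (counitHom hq hodd hN)
    (by
      apply hom_ext <;>
        simp [comulHom, KInv, TensorProduct.add_tmul, TensorProduct.tmul_add,
          Algebra.TensorProduct.one_def, add_assoc, Algebra.TensorProduct.tmul_pow])
    (by apply hom_ext <;> simp [comulHom, counitHom])
    (by apply hom_ext <;> simp [comulHom, counitHom, KInv])

theorem comul_E : Coalgebra.comul (R := k) (E hq hodd hN) =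
    E hq hodd hN ⊗ₜ 1 + K hq hodd hN ⊗ₜ E hq hodd hN := lift_E ..

theorem comul_F : Coalgebra.comul (R := k) (F hq hodd hN) =
    F hq hodd hN ⊗ₜ KInv hq hodd hN + 1 ⊗ₜ F hq hodd hN := lift_F ..

theorem comul_K : Coalgebra.comul (R := k) (K hq hodd hN) = K hq hodd hN ⊗ₜ K hq hodd hN :=
  lift_K ..

theorem counit_E : Coalgebra.counit (R := k) (E hq hodd hN) = 0 := lift_E ..

theorem counit_F : Coalgebra.counit (R := k) (F hq hodd hN) = 0 := lift_F ..

theorem counit_K : Coalgebra.counit (R := k) (K hq hodd hN) = 1 := lift_K ..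

/-- The antipode as a linear map. -/
def antipodeLin : SmallUqSl2 hq hodd hN →ₗ[k] SmallUqSl2 hq hodd hN :=
  (MulOpposite.opLinearEquiv k).symm.toLinearMap ∘ₗ (antipodeHom hq hodd hN).toLinearMap

theorem antipodeLin_E :
    antipodeLin hq hodd hN (E hq hodd hN) = -(KInv hq hodd hN * E hq hodd hN) := by
  simp [antipodeLin, antipodeHom]

theorem antipodeLin_F :
    antipodeLin hq hodd hN (F hq hodd hN) = -(F hq hodd hN * K hq hodd hN) := by
  simp [antipodeLin, antipodeHom]

theorem antipodeLin_K : antipodeLin hq hodd hN (K hq hodd hN) = KInv hq hodd hN := by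
  simp [antipodeLin, antipodeHom]

theorem antipodeLin_KInv : antipodeLin hq hodd hN (KInv hq hodd hN) = K hq hodd hN := by
  rw [← KInv_pow_pred hq hodd hN]
  simp [antipodeLin, antipodeHom, KInv]

theorem antipodeLin_one : antipodeLin hq hodd hN 1 = 1 := by
  simp [antipodeLin]

instance : HopfAlgebra k (SmallUqSl2 hq hodd hN) where
  antipode := antipodeLin hq hodd hN
  mul_antipode_rTensor_comul :=
    antipode_left_of_adjoin (antipodeHom hq hodd hN) _ (adjoin_eq_top hq hodd hN) _ rfl (by
      rintro a (rfl | rfl | rfl)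
      · simp [comul_E, counit_E, antipodeLin_E, antipodeLin_K]
      · simp [comul_F, counit_F, antipodeLin_F, antipodeLin_one, mul_assoc, K_mul_KInv]
      · simp [comul_K, counit_K, antipodeLin_K, KInv_mul_K])
  mul_antipode_lTensor_comul :=
    antipode_right_of_adjoin (antipodeHom hq hodd hN) _ (adjoin_eq_top hq hodd hN) _ rfl (by
      rintro a (rfl | rfl | rfl)
      · simp [comul_E, counit_E, antipodeLin_E, antipodeLin_one, ← mul_assoc, K_mul_KInv]
      · simp [comul_F, counit_F, antipodeLin_F, antipodeLin_KInv]
      · simp [comul_K, counit_K, antipodeLin_K, K_mul_KInv])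

theorem antipode_E :
    HopfAlgebra.antipode k (E hq hodd hN) = -(KInv hq hodd hN * E hq hodd hN) :=
  antipodeLin_E hq hodd hN

theorem antipode_F : HopfAlgebra.antipode k (F hq hodd hN) = -(F hq hodd hN * K hq hodd hN) :=
  antipodeLin_F hq hodd hN

theorem antipode_K : HopfAlgebra.antipode k (K hq hodd hN) = KInv hq hodd hN :=
  antipodeLin_K hq hodd hN

/-- The monomials `E ^ i F ^ j K ^ l`, `i, j, l < N`, span `u_q(sl₂)`. -/
theorem span_monomials :
    Submodule.span k (Set.range fun p : Fin N × Fin N × Fin N =>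
      E hq hodd hN ^ (p.1 : ℕ) * F hq hodd hN ^ (p.2.1 : ℕ) * K hq hodd hN ^ (p.2.2 : ℕ)) = ⊤ := by
  set W := Submodule.span k (Set.range fun p : Fin N × Fin N × Fin N =>
      E hq hodd hN ^ (p.1 : ℕ) * F hq hodd hN ^ (p.2.1 : ℕ) * K hq hodd hN ^ (p.2.2 : ℕ)) with hW
  have hmem : ∀ i j l : ℕ, E hq hodd hN ^ i * F hq hodd hN ^ j * K hq hodd hN ^ l ∈ W := by
    intro i j l
    by_cases hi : i < N
    · by_cases hj : j < N
      · rw [← pow_mod_of_pow_eq_one (K_pow hq hodd hN) l]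
        exact Submodule.subset_span
          ⟨(⟨i, hi⟩, ⟨j, hj⟩, ⟨l % N, Nat.mod_lt _ (by omega)⟩), rfl⟩
      · rw [pow_eq_zero_of_le (not_lt.mp hj) (F_pow hq hodd hN), mul_zero, zero_mul]
        exact W.zero_mem
    · rw [pow_eq_zero_of_le (not_lt.mp hi) (E_pow hq hodd hN), zero_mul, zero_mul]
      exact W.zero_mem
  have hind : ∀ f : SmallUqSl2 hq hodd hN →ₗ[k] SmallUqSl2 hq hodd hN,
      (∀ i j l : ℕ, f (E hq hodd hN ^ i * F hq hodd hN ^ j * K hq hodd hN ^ l) ∈ W) →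
      ∀ w ∈ W, f w ∈ W := by
    intro f hf w hw
    have : W ≤ W.comap f := by
      conv_lhs => rw [hW]
      rw [Submodule.span_le]
      rintro _ ⟨p, rfl⟩
      exact hf _ _ _
    exact this hw
  have hK : ∀ w ∈ W, w * K hq hodd hN ∈ W :=
    hind (LinearMap.mulRight k (K hq hodd hN)) fun i j l => by
      rw [LinearMap.mulRight_apply, mul_assoc, ← pow_succ]
      exact hmem _ _ _
  have hKp : ∀ l : ℕ, ∀ w ∈ W, w * K hq hodd hN ^ l ∈ W := by
    intro l
    induction l with
    | zero => intro w hw; simpa using hw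
    | succ l ih => intro w hw; rw [pow_succ, ← mul_assoc]; exact hK _ (ih w hw)
  have hE : ∀ w ∈ W, E hq hodd hN * w ∈ W :=
    hind (LinearMap.mulLeft k (E hq hodd hN)) fun i j l => by
      rw [LinearMap.mulLeft_apply, ← mul_assoc, ← mul_assoc, ← pow_succ']
      exact hmem _ _ _
  have hEp : ∀ i : ℕ, ∀ w ∈ W, E hq hodd hN ^ i * w ∈ W := by
    intro i
    induction i with
    | zero => intro w hw; simpa using hw
    | succ i ih => intro w hw; rw [pow_succ', mul_assoc]; exact hE _ (ih w hw)
  have hF : ∀ w ∈ W, w * F hq hodd hN ∈ W :=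
    hind (LinearMap.mulRight k (F hq hodd hN)) fun i j l => by
      rw [LinearMap.mulRight_apply, mul_assoc, qcomm_pow_left (K_mul_F hq hodd hN), mul_smul_comm,
        ← mul_assoc, mul_assoc (E hq hodd hN ^ i), ← pow_succ]
      exact W.smul_mem _ (hmem _ _ _)
  have hFE : ∀ j : ℕ, F hq hodd hN ^ j * E hq hodd hN ∈ W := by
    intro j
    induction j with
    | zero => simpa using hmem 1 0 0
    | succ j ih =>
      have h1 : F hq hodd hN * E hq hodd hN = E hq hodd hN * F hq hodd hN -
          (q - q⁻¹)⁻¹ • (K hq hodd hN - K hq hodd hN ^ (N - 1)) := by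
        have := E_F hq hodd hN
        rw [KInv] at this
        rw [← this]; abel
      rw [pow_succ, mul_assoc, h1, mul_sub, ← mul_assoc, mul_smul_comm, mul_sub]
      refine W.sub_mem (hF _ ih) (W.smul_mem _ (W.sub_mem ?_ ?_))
      · simpa using hmem 0 j 1
      · simpa using hmem 0 j (N - 1)
  have hEr : ∀ w ∈ W, w * E hq hodd hN ∈ W :=
    hind (LinearMap.mulRight k (E hq hodd hN)) fun i j l => by
      rw [LinearMap.mulRight_apply, mul_assoc, qcomm_pow_left (K_mul_E hq hodd hN), mul_smul_comm,
        ← mul_assoc, mul_assoc (E hq hodd hN ^ i)]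
      exact W.smul_mem _ (hKp _ _ (hEp _ _ (hFE j)))
  refine span_eq_top_of_mul_mem (adjoin_eq_top hq hodd hN) ?_ ?_
  · simpa using hmem 0 0 0
  · rintro a (rfl | rfl | rfl)
    · exact hEr
    · exact hF
    · exact hK

instance : Module.Finite k (SmallUqSl2 hq hodd hN) :=
  ⟨Submodule.fg_def.mpr ⟨_, Set.finite_range _, span_monomials hq hodd hN⟩⟩

end SmallUqSl2

end SmallQuantumGroup

end

end HopfIndicator

namespace HopfIndicator

noncomputable section

/-! ### Quadratic character sums on `ZMod N` -/

section CharacterSum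

variable {k : Type*} [Field k] {N : ℕ} [NeZero N]

theorem card_natCast_mul_eq_zero (n : ℕ) :
    (Finset.univ.filter fun i : ZMod N => (n : ZMod N) * i = 0).card = Nat.gcd N n := by
  have h := IsAddCyclic.card_nsmulAddMonoidHom_ker (G := ZMod N) n
  rw [Nat.card_zmod] at h
  rw [← h, ← SetLike.coe_sort_coe, Nat.card_coe_set_eq, ← Set.ncard_coe_finset]
  congr 1
  ext i
  simp [AddMonoidHom.mem_ker, nsmul_eq_mul]

theorem exists_natCast_mul_add_eq_zero {n : ℕ} {β : ZMod N}
    (h : ∀ t : ZMod N, (n : ZMod N) * t = 0 → t * β = 0) : ∃ i : ZMod N, (n : ZMod N) * i + β = 0 := by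
  have hN := NeZero.pos N
  set d := Nat.gcd N n with hd
  have hd0 : 0 < d := Nat.gcd_pos_of_pos_left _ hN
  have h1 : ((N / d : ℕ) : ZMod N) * β = 0 := by
    apply h
    rw [← Nat.cast_mul, ZMod.natCast_eq_zero_iff]
    obtain ⟨e, he⟩ := Nat.gcd_dvd_right N n
    obtain ⟨f, hf⟩ := Nat.gcd_dvd_left N n
    rw [← hd] at he hf
    refine ⟨e, ?_⟩
    conv_lhs => rw [he]
    conv_rhs => rw [hf]
    rw [hf, Nat.mul_div_cancel_left _ hd0]
    ring
  rw [← ZMod.natCast_zmod_val β, ← Nat.cast_mul, ZMod.natCast_eq_zero_iff] at h1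
  have h2 : d ∣ β.val := by
    have h3 : N / d * d = N := Nat.div_mul_cancel (Nat.gcd_dvd_left N n)
    have h4 : 0 < N / d := Nat.div_pos (Nat.le_of_dvd hN (Nat.gcd_dvd_left N n)) hd0
    exact Nat.dvd_of_mul_dvd_mul_left h4 (by rwa [h3])
  obtain ⟨e, he⟩ := h2
  refine ⟨-((Nat.gcdB N n : ZMod N) * e), ?_⟩
  have hb := congrArg (fun z : ℤ => (z : ZMod N)) (Nat.gcd_eq_gcd_ab N n)
  simp only [Int.cast_natCast, Int.cast_add, Int.cast_mul, CharP.cast_eq_zero, zero_mul,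
    zero_add] at hb
  rw [← ZMod.natCast_zmod_val β, he, Nat.cast_mul, hb]
  ring

theorem sum_fibre_mul_sum_fibre (hodd : Odd N) {χ : AddChar (ZMod N) k}
    (hχ : ∀ i, χ i = 1 → i = 0) (n : ℕ) (β φ : ZMod N) :
    (∑ i : ZMod N with (n : ZMod N) * i + β = 0, χ (i * β)) *
        ∑ l : ZMod N with (n : ZMod N) * l + φ = 0, χ (-(l * φ)) =
      (Nat.gcd N n : k) *
        ∑ j : ZMod N with (n : ZMod N) * j + (β + φ) = 0, χ (j * (β - φ)) := by
  by_cases hβ : ∃ i : ZMod N, (n : ZMod N) * i + β = 0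
  · obtain ⟨i₀, hi₀⟩ := hβ
    have hcard : (Finset.univ.filter fun i : ZMod N => (n : ZMod N) * i + β = 0).card =
        Nat.gcd N n := by
      rw [← card_natCast_mul_eq_zero]
      refine Finset.card_bij (fun i _ => i - i₀) ?_ ?_ ?_
      · intro i hi
        simp only [Finset.mem_filter, Finset.mem_univ, true_and] at hi ⊢
        linear_combination hi - hi₀
      · intro i _ j _ h
        simpa using h
      · intro i hi
        simp only [Finset.mem_filter, Finset.mem_univ, true_and] at hi
        refine ⟨i + i₀, ?_, by simp⟩
        simp only [Finset.mem_filter, Finset.mem_univ, true_and]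
        linear_combination hi + hi₀
    rw [Finset.sum_mul, ← hcard, ← nsmul_eq_mul, ← Finset.sum_const]
    refine Finset.sum_congr rfl fun i hi => ?_
    simp only [Finset.mem_filter, Finset.mem_univ, true_and] at hi
    rw [Finset.mul_sum]
    refine Finset.sum_bij (fun l _ => i + l) ?_ ?_ ?_ ?_
    · intro l hl
      simp only [Finset.mem_filter, Finset.mem_univ, true_and] at hl ⊢
      linear_combination hi + hl
    · intro l _ m _ h
      simpa using h
    · intro j hj
      simp only [Finset.mem_filter, Finset.mem_univ, true_and] at hj
      refine ⟨j - i, ?_, by simp⟩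
      simp only [Finset.mem_filter, Finset.mem_univ, true_and]
      linear_combination hj - hi
    · intro l hl
      simp only [Finset.mem_filter, Finset.mem_univ, true_and] at hl
      rw [← AddChar.map_add_eq_mul]
      congr 1
      linear_combination i * hl - l * hi
  · have h0 : ∀ i : ZMod N, ¬ ((n : ZMod N) * i + β = 0) := fun i hi => hβ ⟨i, hi⟩
    rw [Finset.sum_eq_zero (s := Finset.univ.filter fun i : ZMod N => (n : ZMod N) * i + β = 0)
      (fun i hi => absurd (Finset.mem_filter.mp hi).2 (h0 i)), zero_mul]
    symm
    rw [mul_eq_zero]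
    right
    by_contra hsum
    obtain ⟨j₀, hj₀⟩ : ∃ j : ZMod N, (n : ZMod N) * j + (β + φ) = 0 := by
      by_contra hne
      push Not at hne
      exact hsum (Finset.sum_eq_zero fun j hj => absurd (Finset.mem_filter.mp hj).2 (hne j))
    refine hβ (exists_natCast_mul_add_eq_zero fun t ht => ?_)
    have hshift : χ (t * (β - φ)) *
        ∑ j : ZMod N with (n : ZMod N) * j + (β + φ) = 0, χ (j * (β - φ)) =
        ∑ j : ZMod N with (n : ZMod N) * j + (β + φ) = 0, χ (j * (β - φ)) := by
      rw [Finset.mul_sum]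
      refine Finset.sum_bij (fun j _ => t + j) ?_ ?_ ?_ ?_
      · intro l hl
        simp only [Finset.mem_filter, Finset.mem_univ, true_and] at hl ⊢
        linear_combination hl + ht
      · intro l _ m _ h
        simpa using h
      · intro j hj
        simp only [Finset.mem_filter, Finset.mem_univ, true_and] at hj
        refine ⟨j - t, ?_, by simp⟩
        simp only [Finset.mem_filter, Finset.mem_univ, true_and]
        linear_combination hj - ht
      · intro l _
        rw [← AddChar.map_add_eq_mul]
        congr 1
        ring
    have h1 := hχ _ (mul_right_cancel₀ hsum (hshift.trans (one_mul _).symm))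
    have h2 : IsUnit (2 : ZMod N) := by
      have := (ZMod.isUnit_iff_coprime 2 N).mpr (Nat.coprime_two_left.mpr hodd)
      exact_mod_cast this
    refine h2.mul_left_cancel ?_
    linear_combination h1 + t * hj₀ - j₀ * ht

end CharacterSum

/-! ### Coefficients of Sweedler powers -/

section Coeff

variable {k : Type*} [Field k] {N : ℕ}

/-- `sweedlerCoeff w m a B` is the coefficient of `x ^ a g ^ B` in the `m`-th Sweedler power of
`x ^ a`, where `Δ(x) = x ⊗ 1 + g ⊗ x` and `g x = w x g`. -/
def sweedlerCoeff (w : k) : ℕ → ℕ → ZMod N → k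
  | 0, a, B => if a = 0 ∧ B = 0 then 1 else 0
  | m + 1, a, B => ∑ i ∈ Finset.range (a + 1),
      qChoose w a i * w ^ ((a - i) * (a - i)) * sweedlerCoeff w m (a - i) (B - ((a - i : ℕ) : ZMod N))

theorem sweedlerCoeff_zero_right (w : k) (m : ℕ) (D : ZMod N) :
    sweedlerCoeff w m 0 D = if D = 0 then 1 else 0 := by
  induction m generalizing D with
  | zero => simp [sweedlerCoeff]
  | succ m ih => simp [sweedlerCoeff, ih, qChoose_zero_right]

/-- The contribution of `x ^ a g ^ B` to the `n`-th indicator of the Taft algebra. -/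
def taftTerm [NeZero N] (w : k) (n a : ℕ) (B : ZMod N) : k :=
  (-1) ^ a * w ^ a.choose 2 * sweedlerCoeff w (n - 1) a B *
    ∑ j : ZMod N with (n : ZMod N) * j + (B + a) = 0, w ^ (j * (B + a)).val

end Coeff

/-! ### Conjugate pairs -/

section IsConjPair

variable {k : Type*} [Field k]

/-- `x = ∑ aᵢ ωᵢ` and `y = ∑ aᵢ ωᵢ⁻¹` for some integers `aᵢ` and roots of unity `ωᵢ`. -/
def IsConjPair (x y : k) : Prop := ∃ z, evalRoots k z = x ∧ evalRootsInv k z = y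

namespace IsConjPair

variable {x y x' y' : k}

theorem zero : IsConjPair (0 : k) 0 := ⟨0, map_zero _, map_zero _⟩

theorem one : IsConjPair (1 : k) 1 := ⟨1, map_one _, map_one _⟩

theorem neg (h : IsConjPair x y) : IsConjPair (-x) (-y) := by
  obtain ⟨z, rfl, rfl⟩ := h
  exact ⟨-z, map_neg _ _, map_neg _ _⟩

theorem add (h : IsConjPair x y) (h' : IsConjPair x' y') : IsConjPair (x + x') (y + y') := by
  obtain ⟨z, rfl, rfl⟩ := h
  obtain ⟨z', rfl, rfl⟩ := h'
  exact ⟨z + z', map_add _ _ _, map_add _ _ _⟩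

theorem mul (h : IsConjPair x y) (h' : IsConjPair x' y') : IsConjPair (x * x') (y * y') := by
  obtain ⟨z, rfl, rfl⟩ := h
  obtain ⟨z', rfl, rfl⟩ := h'
  exact ⟨z * z', map_mul _ _ _, map_mul _ _ _⟩

theorem pow (h : IsConjPair x y) (m : ℕ) : IsConjPair (x ^ m) (y ^ m) := by
  obtain ⟨z, rfl, rfl⟩ := h
  exact ⟨z ^ m, map_pow _ _ _, map_pow _ _ _⟩

theorem sum {ι : Type*} (s : Finset ι) {f g : ι → k} (h : ∀ i ∈ s, IsConjPair (f i) (g i)) :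
    IsConjPair (∑ i ∈ s, f i) (∑ i ∈ s, g i) := by
  induction s using Finset.cons_induction with
  | empty => exact zero
  | cons a s ha ih =>
    rw [Finset.sum_cons, Finset.sum_cons]
    exact (h a (by simp)).add (ih fun i hi => h i (by simp [hi]))

theorem of_isPrimitiveRoot {w : k} {N : ℕ} [NeZero N] (hw : IsPrimitiveRoot w N) :
    IsConjPair w w⁻¹ := by
  have hw0 : w ≠ 0 := hw.ne_zero (NeZero.ne N)
  have hfin : Units.mk0 w hw0 ∈ CommGroup.torsion kˣ := by
    refine isOfFinOrder_iff_pow_eq_one.mpr ⟨N, NeZero.pos N, ?_⟩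
    ext
    simp [hw.pow_eq_one]
  refine ⟨MonoidAlgebra.of ℤ _ ⟨_, hfin⟩, ?_, ?_⟩
  · simp [evalRoots]
  · simp [evalRootsInv]

theorem qChoose {w v : k} (h : IsConjPair w v) :
    ∀ n i, IsConjPair (HopfIndicator.qChoose w n i) (HopfIndicator.qChoose v n i)
  | _, 0 => by simpa only [qChoose_zero_right] using one
  | 0, _ + 1 => zero
  | n + 1, i + 1 => by
    rw [qChoose_succ_succ, qChoose_succ_succ]
    exact (qChoose h n i).add ((h.pow _).mul (qChoose h n (i + 1)))

theorem sweedlerCoeff {N : ℕ} {w v : k} (h : IsConjPair w v) (m : ℕ) : ∀ (a : ℕ) (B : ZMod N),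
    IsConjPair (HopfIndicator.sweedlerCoeff w m a B) (HopfIndicator.sweedlerCoeff v m a B) := by
  induction m with
  | zero =>
    intro a B
    unfold HopfIndicator.sweedlerCoeff
    split_ifs
    · exact one
    · exact zero
  | succ m ih =>
    intro a B
    unfold HopfIndicator.sweedlerCoeff
    exact sum _ fun i _ => ((h.qChoose _ _).mul (h.pow _)).mul (ih _ _)

theorem taftTerm {N : ℕ} [NeZero N] {w v : k} (h : IsConjPair w v) (n a : ℕ) (B : ZMod N) :
    IsConjPair (HopfIndicator.taftTerm w n a B) (HopfIndicator.taftTerm v n a B) :=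
  (((one.neg.pow _).mul (h.pow _)).mul (h.sweedlerCoeff _ _ _)).mul (sum _ fun _ _ => h.pow _)

theorem exists_absSq_eq [CharZero k] (h : IsConjPair x y) :
    ∃ hx : x ∈ cyclotomicSubring k, absSq ⟨x, hx⟩ = x * y := by
  obtain ⟨z, rfl, rfl⟩ := h
  exact ⟨⟨z, rfl⟩, congrArg _ (cyclotomicConj_evalRoots z)⟩

end IsConjPair

end IsConjPair

/-! ### Powers with exponents in `ZMod N` -/

section ModPow

variable {N : ℕ} {M : Type*} [Monoid M]

/-- `y ^ i` for an exponent `i` modulo `N`, meaningful when `y ^ N = 1`. -/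
def modPow (y : M) (i : ZMod N) : M := y ^ i.val

theorem modPow_zero (y : M) : modPow y (0 : ZMod N) = 1 := by simp [modPow]

variable {y : M}

theorem modPow_natCast (hy : y ^ N = 1) (i : ℕ) : modPow y (i : ZMod N) = y ^ i := by
  rw [modPow, ZMod.val_natCast, ← pow_eq_pow_mod _ hy]

theorem modPow_one (hy : y ^ N = 1) : modPow y (1 : ZMod N) = y := by
  have := modPow_natCast hy 1
  rwa [pow_one, Nat.cast_one] at this

theorem modPow_nsmul (hy : y ^ N = 1) (m : ℕ) (i : ZMod N) :
    modPow y (m * i : ZMod N) = modPow y i ^ m := by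
  rw [modPow, modPow, ZMod.val_mul, ← pow_eq_pow_mod _ hy, ZMod.val_natCast, ← pow_mul, mul_comm,
    pow_mul, ← pow_eq_pow_mod m (by rw [← pow_mul, mul_comm, pow_mul, hy, one_pow]), ← pow_mul, mul_comm]

variable [NeZero N]

theorem modPow_add (hy : y ^ N = 1) (i j : ZMod N) :
    modPow y (i + j) = modPow y i * modPow y j := by
  rw [modPow, ZMod.val_add, ← pow_eq_pow_mod _ hy, pow_add, modPow, modPow]

theorem modPow_neg_one (hy : y ^ N = 1) : modPow y (-1 : ZMod N) = y ^ (N - 1) := by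
  rw [← modPow_natCast hy, Nat.cast_sub (NeZero.one_le)]
  simp

theorem modPow_neg {G : Type*} [DivisionRing G] {y : G} (hy : y ^ N = 1) (i : ZMod N) :
    modPow y (-i) = (modPow y i)⁻¹ := by
  refine eq_inv_of_mul_eq_one_left ?_
  rw [← modPow_add hy, neg_add_cancel, modPow_zero]

theorem modPow_inv {G : Type*} [DivisionRing G] {y : G} (hy : y ^ N = 1) (i : ZMod N) :
    modPow y⁻¹ i = modPow y (-i) := by
  rw [modPow_neg hy, modPow, modPow, inv_pow]

end ModPow

/-! ### Hopf algebras with two skew primitive elements -/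

section SkewPair

theorem smodEq_of_eq {R M : Type*} [Ring R] [AddCommGroup M] [Module R M] {U : Submodule R M}
    {x y : M} (h : x = y) : x ≡ y [SMOD U] := by rw [h]

theorem sum_comm_pairs {ι κ M : Type*} [AddCommMonoid M] (s t : Finset ι) (u v : Finset κ)
    (f : ι → ι → κ → κ → M) :
    ∑ i ∈ s, ∑ l ∈ t, ∑ B ∈ u, ∑ D ∈ v, f i l B D =
      ∑ B ∈ u, ∑ D ∈ v, ∑ i ∈ s, ∑ l ∈ t, f i l B D := by
  calc _ = ∑ i ∈ s, ∑ B ∈ u, ∑ l ∈ t, ∑ D ∈ v, f i l B D :=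
        Finset.sum_congr rfl fun _ _ => Finset.sum_comm
    _ = ∑ B ∈ u, ∑ i ∈ s, ∑ D ∈ v, ∑ l ∈ t, f i l B D := by
        rw [Finset.sum_comm]
        exact Finset.sum_congr rfl fun _ _ => Finset.sum_congr rfl fun _ _ => Finset.sum_comm
    _ = _ := Finset.sum_congr rfl fun _ _ => Finset.sum_comm

open Coalgebra

variable {k : Type*} [Field k] {H : Type*} [Ring H] [HopfAlgebra k H]

theorem sweedlerPower_zero (h : H) :
    sweedlerPower k H 0 h = algebraMap k H (counit h) := by
  rw [sweedlerPower, pow_zero]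
  rfl

theorem sweedlerPower_succ (m : ℕ) (h : H) :
    sweedlerPower k H (m + 1) h =
      LinearMap.mul' k H (TensorProduct.map LinearMap.id (sweedlerPower k H m) (comul h)) := by
  rw [sweedlerPower, pow_succ']
  rfl

/-- Elements `E`, `Y`, `K` of a Hopf algebra with `K` group-like of order dividing `N`,
`E` and `Y` of opposite weights and skew primitive, which commute up to a scalar and terms of
lower degree. -/
structure IsSkewPair (N : ℕ) (ω κ : k) (E Y K : H) : Prop where
  root_pow : ω ^ N = 1
  K_pow : K ^ N = 1
  K_mul_E : K * E = ω • (E * K)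
  K_mul_Y : K * Y = ω⁻¹ • (Y * K)
  Y_mul_E : Y * E = ω • (E * Y) + κ • (K ^ 2 - 1)
  comul_E : comul (R := k) E = E ⊗ₜ 1 + K ⊗ₜ E
  comul_Y : comul (R := k) Y = Y ⊗ₜ 1 + K ⊗ₜ Y
  comul_K : comul (R := k) K = K ⊗ₜ K
  counit_E : counit (R := k) E = 0
  counit_Y : counit (R := k) Y = 0
  counit_K : counit (R := k) K = 1
  antipode_E : HopfAlgebra.antipode k E = -(K ^ (N - 1) * E)
  antipode_Y : HopfAlgebra.antipode k Y = -(K ^ (N - 1) * Y)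
  antipode_K : HopfAlgebra.antipode k K = K ^ (N - 1)

/-- The monomial `E ^ a Y ^ c K ^ j`. -/
def monomial {N : ℕ} (E Y K : H) (a c : ℕ) (j : ZMod N) : H := E ^ a * Y ^ c * modPow K j

variable (k) in
/-- The span of the monomials `E ^ a Y ^ c K ^ j` with `a + c < d`. -/
def degreeLT (N : ℕ) (E Y K : H) (d : ℕ) : Submodule k H :=
  Submodule.span k {z | ∃ (a c : ℕ) (j : ZMod N), a + c < d ∧ z = monomial E Y K a c j}

section

variable {N : ℕ} {E Y K : H}

theorem degreeLT_mono {d d' : ℕ} (h : d ≤ d') : degreeLT k N E Y K d ≤ degreeLT k N E Y K d' :=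
  Submodule.span_mono fun _ ⟨a, c, j, hlt, hz⟩ => ⟨a, c, j, hlt.trans_le h, hz⟩

theorem monomial_mem_degreeLT {a c d : ℕ} (j : ZMod N) (h : a + c < d) :
    monomial E Y K a c j ∈ degreeLT k N E Y K d :=
  Submodule.subset_span ⟨a, c, j, h, rfl⟩

theorem map_mem_of_monomial {W : Submodule k H} {d : ℕ} (f : H →ₗ[k] H)
    (hf : ∀ (a c : ℕ) (j : ZMod N), a + c < d → f (monomial E Y K a c j) ∈ W) {u : H}
    (hu : u ∈ degreeLT k N E Y K d) : f u ∈ W := by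
  have : degreeLT k N E Y K d ≤ W.comap f := by
    refine Submodule.span_le.mpr ?_
    rintro _ ⟨a, c, j, h, rfl⟩
    exact hf a c j h
  exact this hu

theorem E_mul_mem {d : ℕ} {u : H} (hu : u ∈ degreeLT k N E Y K d) :
    E * u ∈ degreeLT k N E Y K (d + 1) :=
  map_mem_of_monomial (LinearMap.mulLeft k E) (fun a c j h => by
    rw [LinearMap.mulLeft_apply, monomial, ← mul_assoc, ← mul_assoc, ← pow_succ']
    exact monomial_mem_degreeLT j (by omega)) hu

theorem E_pow_mul_mem (a : ℕ) {d : ℕ} {u : H} (hu : u ∈ degreeLT k N E Y K d) :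
    E ^ a * u ∈ degreeLT k N E Y K (d + a) := by
  induction a with
  | zero => simpa using hu
  | succ a ih => rw [pow_succ', mul_assoc, ← add_assoc]; exact E_mul_mem ih

end

namespace IsSkewPair

variable {N : ℕ} {ω κ : k} {E Y K : H} (h : IsSkewPair N ω κ E Y K)

include h

theorem modPow_K_mul_E_pow (i : ZMod N) (a : ℕ) :
    modPow K i * E ^ a = modPow ω (i * a : ZMod N) • (E ^ a * modPow K i) := by
  have h1 : modPow K i * E = modPow ω i • (E * modPow K i) := qcomm_pow_left h.K_mul_E i.val
  rw [qcomm_pow_right h1, mul_comm, modPow_nsmul h.root_pow]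

variable [NeZero N]

theorem scalar_add (i j : ZMod N) : modPow ω (i + j) = modPow ω i * modPow ω j :=
  modPow_add h.root_pow i j

theorem modPow_K_mul_Y_pow (i : ZMod N) (c : ℕ) :
    modPow K i * Y ^ c = modPow ω (-(i * c) : ZMod N) • (Y ^ c * modPow K i) := by
  have h1 : modPow K i * Y = modPow ω⁻¹ i • (Y * modPow K i) := qcomm_pow_left h.K_mul_Y i.val
  rw [qcomm_pow_right h1, modPow_inv h.root_pow, ← modPow_nsmul h.root_pow]
  congr 2
  ring

theorem modPow_K_mul_monomial (i : ZMod N) (a c : ℕ) (j : ZMod N) :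
    modPow K i * monomial E Y K a c j =
      modPow ω (i * (a - c) : ZMod N) • monomial E Y K a c (i + j) := by
  rw [monomial, monomial, ← mul_assoc, ← mul_assoc, h.modPow_K_mul_E_pow, smul_mul_assoc,
    smul_mul_assoc, mul_assoc (E ^ a), h.modPow_K_mul_Y_pow, mul_smul_comm, smul_mul_assoc,
    smul_smul, ← h.scalar_add, ← mul_assoc (E ^ a), mul_assoc _ (modPow K i),
    ← modPow_add h.K_pow]
  congr 2
  ring

theorem modPow_K_mul_mem (i : ZMod N) {d : ℕ} {u : H} (hu : u ∈ degreeLT k N E Y K d) :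
    modPow K i * u ∈ degreeLT k N E Y K d :=
  map_mem_of_monomial (LinearMap.mulLeft k (modPow K i)) (fun a c j hlt => by
    rw [LinearMap.mulLeft_apply, h.modPow_K_mul_monomial]
    exact Submodule.smul_mem _ _ (monomial_mem_degreeLT _ hlt)) hu

theorem Y_mul_monomial (a c : ℕ) (j : ZMod N) :
    Y * monomial E Y K a c j ≡ modPow ω (a : ZMod N) • monomial E Y K a (c + 1) j
      [SMOD degreeLT k N E Y K (a + c + 1)] := by
  induction a with
  | zero =>
    rw [Nat.cast_zero, modPow_zero, one_smul, monomial, monomial, pow_zero, one_mul, one_mul,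
      ← mul_assoc, ← pow_succ']
  | succ a ih =>
    have h1 : ∀ c, monomial E Y K (a + 1) c j = E * monomial E Y K a c j := by
      intro c
      simp only [monomial, pow_succ', mul_assoc]
    have h2 : Y * monomial E Y K (a + 1) c j =
        ω • (E * (Y * monomial E Y K a c j)) +
          κ • (modPow K (2 : ZMod N) * monomial E Y K a c j - monomial E Y K a c j) := by
      have e : modPow K (2 : ZMod N) = K ^ 2 := by
        have := modPow_natCast h.K_pow 2
        rwa [Nat.cast_two] at this
      rw [h1, ← mul_assoc, h.Y_mul_E, add_mul, smul_mul_assoc, mul_assoc, smul_mul_assoc, sub_mul,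
        one_mul, e]
    rw [h2, h1]
    rw [SModEq.sub_mem] at ih ⊢
    have h3 := E_mul_mem ih
    rw [mul_sub, mul_smul_comm] at h3
    have h4 : modPow K (2 : ZMod N) * monomial E Y K a c j - monomial E Y K a c j ∈
        degreeLT k N E Y K (a + 1 + c + 1) := by
      refine Submodule.sub_mem _ (h.modPow_K_mul_mem _ ?_) ?_ <;>
        exact monomial_mem_degreeLT _ (by omega)
    have h5 := Submodule.add_mem _ (Submodule.smul_mem _ ω h3)
      (Submodule.smul_mem _ κ (degreeLT_mono (by omega) h4))
    convert degreeLT_mono (d' := a + 1 + c + 1) (by omega) h5 using 1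
    rw [Nat.cast_succ, h.scalar_add, modPow_one h.root_pow]
    module

theorem Y_mul_mem {d : ℕ} {u : H} (hu : u ∈ degreeLT k N E Y K d) :
    Y * u ∈ degreeLT k N E Y K (d + 1) :=
  map_mem_of_monomial (W := degreeLT k N E Y K (d + 1)) (LinearMap.mulLeft k Y) (fun a c j hlt => by
    have h1 := SModEq.sub_mem.mp (h.Y_mul_monomial a c j)
    rw [LinearMap.mulLeft_apply, ← sub_add_cancel (Y * _)]
    exact Submodule.add_mem _ (degreeLT_mono (Nat.succ_le_succ hlt.le) h1)
      (Submodule.smul_mem _ _ (monomial_mem_degreeLT _ (by omega)))) hu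

theorem Y_pow_mul_mem (c : ℕ) {d : ℕ} {u : H} (hu : u ∈ degreeLT k N E Y K d) :
    Y ^ c * u ∈ degreeLT k N E Y K (d + c) := by
  induction c with
  | zero => simpa using hu
  | succ c ih => rw [pow_succ', mul_assoc, ← add_assoc]; exact h.Y_mul_mem ih

theorem Y_pow_mul_monomial (r a c : ℕ) (j : ZMod N) :
    Y ^ r * monomial E Y K a c j ≡ modPow ω (r * a : ZMod N) • monomial E Y K a (r + c) j
      [SMOD degreeLT k N E Y K (r + a + c)] := by
  induction r with
  | zero => simp [modPow_zero]
  | succ r ih =>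
    rw [pow_succ', mul_assoc]
    have h1 := h.Y_mul_mem (SModEq.sub_mem.mp ih)
    rw [mul_sub, ← SModEq.sub_mem, mul_smul_comm] at h1
    refine (h1.mono (degreeLT_mono (by omega))).trans ?_
    have h2 := (h.Y_mul_monomial a (r + c) j).smul (modPow ω (r * a : ZMod N))
    rw [smul_smul, ← h.scalar_add] at h2
    convert h2.mono (degreeLT_mono (d' := r + 1 + a + c) (by omega)) using 3
    · push_cast; ring
    · ring

/-- The product of `E ^ p K ^ i Y ^ r K ^ l` with a monomial, up to terms of lower degree. -/
theorem mul_monomial (p r a c : ℕ) (i l j : ZMod N) :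
    E ^ p * modPow K i * (Y ^ r * modPow K l) * monomial E Y K a c j ≡
      modPow ω (l * (a - c) + r * a + i * (a - c - r) : ZMod N) •
        monomial E Y K (p + a) (r + c) (i + l + j)
      [SMOD degreeLT k N E Y K (p + a + (r + c))] := by
  have h1 := (h.Y_pow_mul_monomial r a c (l + j)).smul (modPow ω (l * (a - c) : ZMod N))
  have h2 := E_pow_mul_mem p (h.modPow_K_mul_mem i (SModEq.sub_mem.mp h1))
  rw [mul_sub, mul_sub, ← SModEq.sub_mem] at h2
  have e1 : E ^ p * (modPow K i * modPow ω (l * (a - c) : ZMod N) • (Y ^ r * monomial E Y K a c (l + j))) =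
      E ^ p * modPow K i * (Y ^ r * modPow K l) * monomial E Y K a c j := by
    simp only [mul_smul_comm, mul_assoc, h.modPow_K_mul_monomial]
  have e2 : E ^ p * (modPow K i * modPow ω (l * (a - c) : ZMod N) •
      modPow ω (r * a : ZMod N) • monomial E Y K a (r + c) (l + j)) =
      modPow ω (l * (a - c) + r * a + i * (a - c - r) : ZMod N) •
        monomial E Y K (p + a) (r + c) (i + l + j) := by
    rw [mul_smul_comm, mul_smul_comm, mul_smul_comm, mul_smul_comm, h.modPow_K_mul_monomial,
      mul_smul_comm, smul_smul, smul_smul, ← h.scalar_add, ← h.scalar_add, monomial, monomial, ← mul_assoc, ← mul_assoc,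
      ← pow_add, add_assoc i]
    congr 2
    push_cast
    ring
  rw [e1, e2] at h2
  exact h2.mono (degreeLT_mono (by omega))

theorem mul_mem (p r : ℕ) (i l : ZMod N) {d : ℕ} {u : H} (hu : u ∈ degreeLT k N E Y K d) :
    E ^ p * modPow K i * (Y ^ r * modPow K l) * u ∈ degreeLT k N E Y K (d + r + p) := by
  simp only [mul_assoc]
  exact E_pow_mul_mem p (h.modPow_K_mul_mem i (h.Y_pow_mul_mem r (h.modPow_K_mul_mem l hu)))

/-! ### Sweedler powers of monomials -/

theorem comul_monomial (a c : ℕ) (j : ZMod N) :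
    comul (R := k) (monomial E Y K a c j) =
      ∑ i ∈ Finset.range (a + 1), ∑ l ∈ Finset.range (c + 1),
        (qChoose ω a i * qChoose ω⁻¹ c l) •
          ((E ^ i * modPow K ((a - i : ℕ) : ZMod N) *
            (Y ^ l * modPow K (((c - l : ℕ) : ZMod N) + j))) ⊗ₜ[k]
              monomial E Y K (a - i) (c - l) j) := by
  have hE : (K ⊗ₜ[k] E) * (E ⊗ₜ[k] (1 : H)) = ω • ((E ⊗ₜ 1) * (K ⊗ₜ E)) := by
    simp [h.K_mul_E, TensorProduct.smul_tmul']
  have hY : (K ⊗ₜ[k] Y) * (Y ⊗ₜ[k] (1 : H)) = ω⁻¹ • ((Y ⊗ₜ 1) * (K ⊗ₜ Y)) := by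
    simp [h.K_mul_Y, TensorProduct.smul_tmul']
  rw [monomial, Bialgebra.comul_mul, Bialgebra.comul_mul, Bialgebra.comul_pow,
    Bialgebra.comul_pow, modPow, Bialgebra.comul_pow, h.comul_E, h.comul_Y, h.comul_K,
    qcomm_add_pow hE, qcomm_add_pow hY, Finset.sum_mul_sum, Finset.sum_mul]
  refine Finset.sum_congr rfl fun i _ => ?_
  rw [Finset.sum_mul]
  refine Finset.sum_congr rfl fun l _ => ?_
  rw [modPow_add h.K_pow, modPow_natCast h.K_pow, modPow_natCast h.K_pow, monomial]
  simp [Algebra.TensorProduct.tmul_pow, smul_smul, modPow, mul_assoc]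
  rw [mul_comm]

/-- The coefficient of `E ^ a Y ^ c K ^ (m j + B + D)` in the `m`-th Sweedler power of
`E ^ a Y ^ c K ^ j`. -/
theorem sweedlerPower_monomial (m : ℕ) : ∀ (a c : ℕ) (j : ZMod N),
    sweedlerPower k H m (monomial E Y K a c j) ≡
      ∑ B : ZMod N, ∑ D : ZMod N,
        (sweedlerCoeff ω m a B * sweedlerCoeff ω⁻¹ m c D * modPow ω (j * (B - D) : ZMod N)) •
          monomial E Y K a c (m * j + B + D : ZMod N)
      [SMOD degreeLT k N E Y K (a + c)] := by
  induction m with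
  | zero =>
    intro a c j
    refine smodEq_of_eq ?_
    rw [sweedlerPower_zero, monomial, Bialgebra.counit_mul, Bialgebra.counit_mul,
      Bialgebra.counit_pow, Bialgebra.counit_pow, modPow, Bialgebra.counit_pow, h.counit_E,
      h.counit_Y, h.counit_K, one_pow, mul_one]
    by_cases ha : a = 0
    · by_cases hc : c = 0
      · simp [sweedlerCoeff, ha, hc, monomial, modPow_zero]
      · simp [sweedlerCoeff, hc]
    · simp [sweedlerCoeff, ha]
  | succ m ih =>
    intro a c j
    rw [sweedlerPower_succ, h.comul_monomial]
    simp only [map_sum, map_smul, TensorProduct.map_tmul, LinearMap.id_apply, LinearMap.mul'_apply]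
    have step : ∀ i ∈ Finset.range (a + 1), ∀ l ∈ Finset.range (c + 1),
        (E ^ i * modPow K ((a - i : ℕ) : ZMod N) *
          (Y ^ l * modPow K (((c - l : ℕ) : ZMod N) + j))) *
            sweedlerPower k H m (monomial E Y K (a - i) (c - l) j) ≡
        ∑ B : ZMod N, ∑ D : ZMod N,
          (sweedlerCoeff ω m (a - i) (B - (a - i : ℕ) : ZMod N) *
            sweedlerCoeff ω⁻¹ m (c - l) (D - (c - l : ℕ) : ZMod N) *
              (ω ^ ((a - i) * (a - i)) * ω⁻¹ ^ ((c - l) * (c - l)) *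
                modPow ω (j * (B - D) : ZMod N))) •
            monomial E Y K a c ((m + 1 : ℕ) * j + B + D : ZMod N) [SMOD degreeLT k N E Y K (a + c)] := by
      intro i hi l hl
      have hi' : i + (a - i) = a := by have := Finset.mem_range.mp hi; omega
      have hl' : l + (c - l) = c := by have := Finset.mem_range.mp hl; omega
      generalize a - i = b at hi' ⊢
      generalize c - l = f at hl' ⊢
      subst hi' hl'
      have h1 := h.mul_mem i l (b : ZMod N) ((f : ZMod N) + j) (SModEq.sub_mem.mp (ih b f j))
      rw [mul_sub, ← SModEq.sub_mem] at h1
      refine (h1.mono (degreeLT_mono (by omega))).trans ?_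
      rw [← (Equiv.subRight (b : ZMod N)).sum_comp, Finset.mul_sum]
      refine SModEq.sum fun B _ => ?_
      rw [← (Equiv.subRight (f : ZMod N)).sum_comp, Finset.mul_sum]
      refine SModEq.sum fun D _ => ?_
      simp only [Equiv.subRight_apply]
      rw [mul_smul_comm]
      refine ((h.mul_monomial i l b f b (f + j) (m * j + (B - b) + (D - f) : ZMod N)).smul
        _).trans (smodEq_of_eq ?_)
      have e : modPow ω (j * (B - b - (D - f)) : ZMod N) *
          modPow ω ((f + j) * (b - f) + l * b + b * (b - f - l) : ZMod N) =
          ω ^ (b * b) * ω⁻¹ ^ (f * f) * modPow ω (j * (B - D) : ZMod N) := by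
        rw [inv_pow, ← modPow_natCast h.root_pow (b * b), ← modPow_natCast h.root_pow (f * f),
          ← modPow_neg h.root_pow, ← h.scalar_add, ← h.scalar_add, ← h.scalar_add]
        congr 1
        push_cast
        ring
      rw [smul_smul, mul_assoc, e]
      congr 2
      push_cast
      ring
    refine (SModEq.sum fun i hi => SModEq.sum fun l hl => (step i hi l hl).smul _).trans
      (smodEq_of_eq ?_)
    simp only [Finset.smul_sum, smul_smul]
    rw [sum_comm_pairs]
    refine Finset.sum_congr rfl fun B _ => Finset.sum_congr rfl fun D _ => ?_
    rw [sweedlerCoeff, sweedlerCoeff, Finset.sum_mul_sum, Finset.sum_mul, Finset.sum_smul]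
    refine Finset.sum_congr rfl fun i _ => ?_
    rw [Finset.sum_mul, Finset.sum_smul]
    refine Finset.sum_congr rfl fun l _ => ?_
    congr 1
    ring

end IsSkewPair

end SkewPair

section SkewPair

open Coalgebra

variable {k : Type*} [Field k] {H : Type*} [Ring H] [HopfAlgebra k H]

theorem antipode_pow (x : H) (m : ℕ) :
    HopfAlgebra.antipode k (x ^ m) = HopfAlgebra.antipode k x ^ m := by
  induction m with
  | zero => simp
  | succ m ih => rw [pow_succ, HopfAlgebra.antipode_mul_antidistrib, ih, ← pow_succ']

theorem neg_pow_eq_smul (x : H) (m : ℕ) : (-x) ^ m = (-1 : k) ^ m • x ^ m := by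
  rw [← neg_one_smul k x, smul_pow]

namespace IsSkewPair

variable {N : ℕ} [NeZero N] {ω κ : k} {E Y K : H} (h : IsSkewPair N ω κ E Y K)

include h

/-! ### The antipode of monomials -/

theorem antipode_modPow (s : ZMod N) :
    HopfAlgebra.antipode k (modPow K s) = modPow K (-s) := by
  rw [modPow, antipode_pow, h.antipode_K, ← modPow_neg_one h.K_pow, ← modPow_nsmul h.K_pow,
    ZMod.natCast_zmod_val]
  congr 1
  ring

theorem K_inv_mul_pow {Z : H} {σ : ZMod N}
    (hZ : ∀ i : ZMod N, modPow K i * Z = modPow ω (i * σ) • (Z * modPow K i)) (a : ℕ) :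
    (K ^ (N - 1) * Z) ^ a =
      modPow ω ((a.choose 2 - a ^ 2) * σ : ZMod N) • (Z ^ a * modPow K (-a : ZMod N)) := by
  induction a with
  | zero => simp [modPow_zero]
  | succ a ih =>
    rw [pow_succ, ih, ← modPow_neg_one h.K_pow, smul_mul_assoc, mul_assoc, ← mul_assoc (modPow K _),
      ← modPow_add h.K_pow, hZ, mul_smul_comm, smul_smul, ← h.scalar_add, ← mul_assoc, ← pow_succ,
      Nat.choose_succ_succ' a 1, Nat.choose_one_right]
    congr 1
    · congr 1
      push_cast
      ring
    · congr 2
      push_cast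
      ring

theorem antipode_monomial (a c : ℕ) (s : ZMod N) :
    HopfAlgebra.antipode k (monomial E Y K a c s) ≡
      ((-1) ^ (a + c) * modPow ω
        (a.choose 2 - a ^ 2 - (c.choose 2 - c ^ 2) - s * (a - c) : ZMod N)) •
          monomial E Y K a c (-s - a - c : ZMod N)
      [SMOD degreeLT k N E Y K (a + c)] := by
  have hE : ∀ i : ZMod N, modPow K i * E = modPow ω (i * 1) • (E * modPow K i) := by
    intro i
    simpa using h.modPow_K_mul_E_pow i 1
  have hY : ∀ i : ZMod N, modPow K i * Y = modPow ω (i * -1) • (Y * modPow K i) := by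
    intro i
    simpa using h.modPow_K_mul_Y_pow i 1
  have e : HopfAlgebra.antipode k (monomial E Y K a c s) =
      ((-1) ^ (a + c) * modPow ω (a.choose 2 - a ^ 2 - (c.choose 2 - c ^ 2) : ZMod N)) •
        (E ^ 0 * modPow K (-s) * (Y ^ c * modPow K (-c : ZMod N)) *
          monomial E Y K a 0 (-a : ZMod N)) := by
    rw [monomial, HopfAlgebra.antipode_mul_antidistrib, HopfAlgebra.antipode_mul_antidistrib,
      antipode_pow, antipode_pow, h.antipode_modPow, h.antipode_E, h.antipode_Y,
      neg_pow_eq_smul (k := k) (_ * Y), neg_pow_eq_smul (k := k) (_ * E), h.K_inv_mul_pow hE, h.K_inv_mul_pow hY,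
      monomial]
    simp only [smul_mul_assoc, mul_smul_comm, smul_smul, pow_zero, one_mul, mul_one, mul_assoc]
    congr 1
    rw [sub_eq_add_neg (_ - _) (_ - _), h.scalar_add, pow_add, mul_neg_one]
    ring
  rw [e]
  have h1 := (h.mul_monomial 0 c a 0 (-s) (-c) (-a : ZMod N)).smul
    ((-1) ^ (a + c) * modPow ω (a.choose 2 - a ^ 2 - (c.choose 2 - c ^ 2) : ZMod N))
  rw [smul_smul, mul_assoc ((-1) ^ (a + c)), ← h.scalar_add] at h1
  convert h1 using 2
  · ring
  · congr 2
    push_cast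
    ring
  · rw [zero_add]
    congr 1
    ring

theorem antipode_mem {d : ℕ} {u : H} (hu : u ∈ degreeLT k N E Y K d) :
    HopfAlgebra.antipode k u ∈ degreeLT k N E Y K d :=
  map_mem_of_monomial (W := degreeLT k N E Y K d) (HopfAlgebra.antipode k) (fun a c s hlt => by
    rw [← sub_add_cancel (HopfAlgebra.antipode k _)]
    exact Submodule.add_mem _
      (degreeLT_mono hlt.le (SModEq.sub_mem.mp (h.antipode_monomial a c s)))
      (Submodule.smul_mem _ _ (monomial_mem_degreeLT _ hlt))) hu

/-! ### The trace -/

theorem antipode_sweedlerPower_monomial (m a c : ℕ) (j : ZMod N) :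
    HopfAlgebra.antipode k (sweedlerPower k H m (monomial E Y K a c j)) ≡
      ∑ B : ZMod N, ∑ D : ZMod N,
        (sweedlerCoeff ω m a B * sweedlerCoeff ω⁻¹ m c D * modPow ω (j * (B - D) : ZMod N) *
          ((-1) ^ (a + c) * modPow ω (a.choose 2 - a ^ 2 - (c.choose 2 - c ^ 2) -
            (m * j + B + D) * (a - c) : ZMod N))) •
          monomial E Y K a c (-(m * j + B + D) - a - c : ZMod N)
      [SMOD degreeLT k N E Y K (a + c)] := by
  have h1 := h.antipode_mem (SModEq.sub_mem.mp (h.sweedlerPower_monomial m a c j))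
  rw [map_sub, ← SModEq.sub_mem] at h1
  refine h1.trans ?_
  simp only [map_sum, map_smul]
  refine SModEq.sum fun B _ => SModEq.sum fun D _ => ?_
  exact ((h.antipode_monomial a c _).smul _).trans (smodEq_of_eq (smul_smul _ _ _))

theorem indicator_eq [Module.Finite k H] {ι : Type*} [Fintype ι]
    (b : Module.Basis (ι × ZMod N) k H) (da dc : ι → ℕ)
    (hb : ∀ i j, b (i, j) = monomial E Y K (da i) (dc i) j)
    (hrepr : ∀ i j, ∀ u ∈ degreeLT k N E Y K (da i + dc i), b.repr u (i, j) = 0)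
    (n : ℕ) (hn : 1 ≤ n) :
    indicator k H n = ∑ i, ∑ B : ZMod N, ∑ D : ZMod N,
      (-1) ^ da i * ω ^ (da i).choose 2 * sweedlerCoeff ω (n - 1) (da i) B *
        ((-1) ^ dc i * ω⁻¹ ^ (dc i).choose 2 * sweedlerCoeff ω⁻¹ (n - 1) (dc i) D) *
        ∑ j : ZMod N with (n : ZMod N) * j + (B + da i + (D + dc i)) = 0,
          modPow ω (j * (B + da i - (D + dc i)) : ZMod N) := by
  classical
  obtain ⟨m, rfl⟩ : ∃ m, n = m + 1 := ⟨n - 1, by omega⟩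
  rw [Nat.add_sub_cancel, indicator, Nat.add_sub_cancel, LinearMap.trace_eq_matrix_trace k b,
    Matrix.trace, Fintype.sum_prod_type]
  refine Finset.sum_congr rfl fun i _ => ?_
  have key : ∀ j : ZMod N, (LinearMap.toMatrix b b
      (HopfAlgebra.antipode k ∘ₗ sweedlerPower k H m)).diag (i, j) =
      ∑ B : ZMod N, ∑ D : ZMod N,
        if ((m + 1 : ℕ) : ZMod N) * j + (B + da i + (D + dc i)) = 0 then
          (-1) ^ da i * ω ^ (da i).choose 2 * sweedlerCoeff ω m (da i) B *
          ((-1) ^ dc i * ω⁻¹ ^ (dc i).choose 2 * sweedlerCoeff ω⁻¹ m (dc i) D) *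
          modPow ω (j * (B + da i - (D + dc i)) : ZMod N) else 0 := by
    intro j
    rw [Matrix.diag_apply, LinearMap.toMatrix_apply, LinearMap.comp_apply, hb]
    have h1 := hrepr i j _ (SModEq.sub_mem.mp
      (h.antipode_sweedlerPower_monomial m (da i) (dc i) j))
    rw [map_sub, Finsupp.sub_apply, sub_eq_zero] at h1
    rw [h1]
    simp only [map_sum, map_smul, Finsupp.finsetSum_apply, Finsupp.smul_apply, ← hb,
      Module.Basis.repr_self, smul_eq_mul]
    refine Finset.sum_congr rfl fun B _ => Finset.sum_congr rfl fun D _ => ?_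
    rw [Finsupp.single_apply]
    have hiff : ((i, -(m * j + B + D) - (da i : ZMod N) - (dc i : ZMod N)) = (i, j)) ↔
        ((m + 1 : ℕ) : ZMod N) * j + (B + da i + (D + dc i)) = 0 := by
      rw [Prod.mk.injEq]
      push_cast
      constructor
      · rintro ⟨-, h2⟩
        linear_combination -h2
      · intro h2
        exact ⟨rfl, by linear_combination -h2⟩
    simp only [hiff]
    split_ifs with h2
    · push_cast at h2
      have e : modPow ω (j * (B - D) : ZMod N) * modPow ω ((da i).choose 2 - (da i) ^ 2 -
            ((dc i).choose 2 - (dc i) ^ 2) - (m * j + B + D) * (da i - dc i) : ZMod N) =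
          ω ^ (da i).choose 2 * ω⁻¹ ^ (dc i).choose 2 *
            modPow ω (j * (B + da i - (D + dc i)) : ZMod N) := by
        rw [inv_pow, ← modPow_natCast h.root_pow, ← modPow_natCast h.root_pow,
          ← modPow_neg h.root_pow, ← h.scalar_add, ← h.scalar_add, ← h.scalar_add]
        congr 1
        linear_combination -(da i - dc i : ZMod N) * h2
      rw [pow_add]
      linear_combination (sweedlerCoeff ω m (da i) B * sweedlerCoeff ω⁻¹ m (dc i) D *
        (-1) ^ da i * (-1) ^ dc i) * e
    · rw [mul_zero]
  rw [Finset.sum_congr rfl fun j _ => key j, Finset.sum_comm]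
  refine Finset.sum_congr rfl fun B _ => ?_
  rw [Finset.sum_comm]
  refine Finset.sum_congr rfl fun D _ => ?_
  rw [← Finset.sum_filter, Finset.mul_sum]

end IsSkewPair

end SkewPair

/-! ### Linear independence of monomials -/

section Independence

variable {k : Type*} [Field k]

theorem pow_apply_eq_zero_of_sum_eq_zero {V : Type*} [AddCommGroup V] [Module k V] {N : ℕ}
    {T : Module.End k V} (hT : T ^ N = 0) {m : Fin N → V}
    (hm : ∀ a, (T ^ (N - 1)) (m a) = 0 → m a = 0) (hsum : ∑ a : Fin N, (T ^ (a : ℕ)) (m a) = 0)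
    (a : Fin N) : (T ^ (N - 1)) (m a) = 0 := by
  induction a using WellFoundedLT.induction with
  | ind a ih =>
    have h1 := congrArg (T ^ (N - 1 - (a : ℕ))) hsum
    rw [map_sum, map_zero, Finset.sum_eq_single a] at h1
    · rwa [← Module.End.mul_apply, ← pow_add, Nat.sub_add_cancel (by omega)] at h1
    · intro b _ hb
      rcases lt_or_gt_of_ne hb with hlt | hgt
      · rw [hm b (ih b hlt), map_zero, map_zero]
      · rw [← Module.End.mul_apply, ← pow_add, pow_eq_zero_of_le (by omega) hT,
          LinearMap.zero_apply]
    · simp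

theorem eq_zero_of_sum_char_eq_zero [CharZero k] {N : ℕ} [NeZero N] {ω : k}
    (hω : IsPrimitiveRoot ω N) {x : ZMod N → k}
    (hx : ∀ r : ZMod N, ∑ j, x j * modPow ω r ^ j.val = 0) (j : ZMod N) : x j = 0 := by
  classical
  have hadd := modPow_add (N := N) hω.pow_eq_one
  have h1 : ∑ r : ZMod N, modPow ω (-(r * j)) * ∑ l, x l * modPow ω r ^ l.val = 0 :=
    Finset.sum_eq_zero fun r _ => by rw [hx, mul_zero]
  simp only [Finset.mul_sum] at h1
  rw [Finset.sum_comm] at h1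
  have h2 : ∀ l, ∑ r : ZMod N, modPow ω (-(r * j)) * (x l * modPow ω r ^ l.val) =
      x l * if l - j = 0 then (Fintype.card (ZMod N) : k) else 0 := by
    intro l
    have := AddChar.sum_mulShift (l - j) (AddChar.zmodChar_primitive_of_primitive_root N hω)
    push_cast at this
    rw [← this, Finset.mul_sum]
    refine Finset.sum_congr rfl fun r _ => ?_
    rw [AddChar.zmodChar_apply, ← modPow_nsmul hω.pow_eq_one, ZMod.natCast_zmod_val,
      mul_left_comm, ← hadd]
    congr 2
    ring
  simp only [h2, sub_eq_zero, mul_ite, mul_zero] at h1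
  rw [Finset.sum_ite_eq' Finset.univ j] at h1
  simpa [NeZero.ne N] using h1

end Independence

/-! ### Baby Verma modules -/

section Verma

variable {k : Type*} [Field k]

/-- The standard basis vectors of `k ^ N`, with `stdVec k N i = 0` for `N ≤ i`. -/
def stdVec (k : Type*) [Field k] (N i : ℕ) : Fin N → k := fun l => if (l : ℕ) = i then 1 else 0

theorem stdVec_eq_zero {N i : ℕ} (h : N ≤ i) : stdVec k N i = 0 := by
  ext l
  have := l.2
  simp [stdVec, show (l : ℕ) ≠ i by omega]

/-- The linear map with given values on the standard basis vectors. -/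
def stdExt {N : ℕ} (f : ℕ → Fin N → k) : Module.End k (Fin N → k) :=
  Fintype.linearCombination k fun i : Fin N => f i

theorem stdExt_stdVec {N : ℕ} {f : ℕ → Fin N → k} (hf : ∀ i, N ≤ i → f i = 0) (i : ℕ) :
    stdExt f (stdVec k N i) = f i := by
  by_cases h : i < N
  · rw [stdExt, Fintype.linearCombination_apply, Finset.sum_eq_single ⟨i, h⟩]
    · simp [stdVec]
    · intro l _ hl
      have : (l : ℕ) ≠ i := fun e => hl (Fin.ext e)
      simp [stdVec, this]
    · simp
  · rw [hf i (by omega), stdVec_eq_zero (by omega), map_zero]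

theorem end_ext_stdVec {N : ℕ} {S T : Module.End k (Fin N → k)}
    (h : ∀ i, S (stdVec k N i) = T (stdVec k N i)) : S = T := by
  refine (Pi.basisFun k (Fin N)).ext fun i => ?_
  have : Pi.basisFun k (Fin N) i = stdVec k N i := by
    ext l
    simp [stdVec, Pi.single_apply, Fin.ext_iff]
  rw [this, h]

/-- The coefficient of `v_{i-1}` in `E v_i`. -/
def vermaCoeff (q t : k) (i : ℕ) : k :=
  ∑ l ∈ Finset.range i, (q - q⁻¹)⁻¹ * (t * (q ^ 2)⁻¹ ^ l - t⁻¹ * (q ^ 2) ^ l)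

/-- The operator `F v_i = v_{i+1}`. -/
def vermaF (k : Type*) [Field k] (N : ℕ) : Module.End k (Fin N → k) :=
  stdExt fun i => stdVec k N (i + 1)

/-- The operator `K v_i = t q ^ (-2 i) v_i`. -/
def vermaK (q t : k) (N : ℕ) : Module.End k (Fin N → k) :=
  stdExt fun i => (t * (q ^ 2)⁻¹ ^ i) • stdVec k N i

/-- The operator `E v_i = vermaCoeff q t i • v_{i-1}`. -/
def vermaE (q t : k) (N : ℕ) : Module.End k (Fin N → k) :=
  stdExt fun i => vermaCoeff q t i • stdVec k N (i - 1)

variable {q t : k} {N : ℕ}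

theorem vermaF_stdVec (i : ℕ) : vermaF k N (stdVec k N i) = stdVec k N (i + 1) :=
  stdExt_stdVec (fun _ h => stdVec_eq_zero (by omega)) i

theorem vermaK_stdVec (i : ℕ) :
    vermaK q t N (stdVec k N i) = (t * (q ^ 2)⁻¹ ^ i) • stdVec k N i :=
  stdExt_stdVec (fun _ h => by rw [stdVec_eq_zero h, smul_zero]) i

theorem vermaCoeff_zero : vermaCoeff q t 0 = 0 := by simp [vermaCoeff]

variable (hq : IsPrimitiveRoot q N) (hodd : Odd N) (hN : 1 < N)

include hq hodd hN in
theorem vermaCoeff_order : vermaCoeff q t N = 0 := by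
  have hω := isPrimitiveRoot_sq hq hodd
  rw [vermaCoeff, ← Finset.mul_sum, Finset.sum_sub_distrib, ← Finset.mul_sum, ← Finset.mul_sum,
    hω.geom_sum_eq_zero hN, hω.inv.geom_sum_eq_zero hN]
  simp

include hq hodd hN in
theorem vermaE_stdVec (i : ℕ) :
    vermaE q t N (stdVec k N i) = vermaCoeff q t i • stdVec k N (i - 1) :=
  stdExt_stdVec (fun j h => by
    rcases h.eq_or_lt with rfl | h
    · rw [vermaCoeff_order hq hodd hN, zero_smul]
    · rw [stdVec_eq_zero (by omega), smul_zero]) i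

theorem vermaF_pow_stdVec (m i : ℕ) :
    (vermaF k N ^ m) (stdVec k N i) = stdVec k N (i + m) := by
  induction m with
  | zero => simp
  | succ m ih => rw [pow_succ', Module.End.mul_apply, ih, vermaF_stdVec, add_assoc]

theorem vermaK_pow_stdVec (m i : ℕ) :
    (vermaK q t N ^ m) (stdVec k N i) = (t * (q ^ 2)⁻¹ ^ i) ^ m • stdVec k N i := by
  induction m with
  | zero => simp
  | succ m ih => rw [pow_succ', Module.End.mul_apply, ih, map_smul, vermaK_stdVec, smul_smul,
      ← pow_succ]

include hq hodd hN in
theorem vermaE_pow_stdVec {m : ℕ} : ∀ {i : ℕ}, i < m →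
    (vermaE q t N ^ m) (stdVec k N i) = 0 := by
  induction m with
  | zero => intro i h; omega
  | succ m ih =>
    intro i h
    rw [pow_succ, Module.End.mul_apply, vermaE_stdVec hq hodd hN, map_smul]
    cases i with
    | zero => rw [vermaCoeff_zero, zero_smul]
    | succ i => rw [Nat.add_sub_cancel, ih (by omega), smul_zero]

include hq hodd in
theorem verma_weight_pow (ht : t ^ N = 1) (i : ℕ) : (t * (q ^ 2)⁻¹ ^ i) ^ N = 1 := by
  rw [mul_pow, ht, ← pow_mul, mul_comm i, pow_mul, (isPrimitiveRoot_sq hq hodd).inv.pow_eq_one,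
    one_pow, one_mul]

/-- The baby Verma module with highest weight `t`, as a representation on `k ^ N`. -/
def vermaRep (ht : t ^ N = 1) : SmallUqSl2 hq hodd hN →ₐ[k] Module.End k (Fin N → k) :=
  SmallUqSl2.lift hq hodd hN (vermaE q t N) (vermaF k N) (vermaK q t N)
    (end_ext_stdVec fun i => by
      by_cases h : i < N
      · rw [vermaE_pow_stdVec hq hodd hN h, LinearMap.zero_apply]
      · rw [stdVec_eq_zero (by omega), map_zero, map_zero])
    (end_ext_stdVec fun i => by
      rw [vermaF_pow_stdVec, stdVec_eq_zero (by omega), LinearMap.zero_apply])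
    (end_ext_stdVec fun i => by
      rw [vermaK_pow_stdVec, verma_weight_pow hq hodd ht, one_smul, Module.End.one_apply])
    (end_ext_stdVec fun i => by
      have hz := SmallUqSl2.sq_ne_zero hq hN
      simp only [Module.End.mul_apply, LinearMap.smul_apply, vermaE_stdVec hq hodd hN,
        vermaK_stdVec, map_smul, smul_smul]
      cases i with
      | zero => simp [vermaCoeff_zero]
      | succ i =>
        rw [Nat.add_sub_cancel]
        congr 1
        linear_combination -(vermaCoeff q t (i + 1) * t * (q ^ 2)⁻¹ ^ i) * mul_inv_cancel₀ hz)
    (end_ext_stdVec fun i => by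
      simp only [Module.End.mul_apply, LinearMap.smul_apply, vermaF_stdVec, vermaK_stdVec,
        map_smul, smul_smul]
      congr 1
      ring)
    (end_ext_stdVec fun i => by
      have h1 : (vermaF k N) (vermaE q t N (stdVec k N i)) =
          vermaCoeff q t i • stdVec k N i := by
        rw [vermaE_stdVec hq hodd hN, map_smul, vermaF_stdVec]
        cases i with
        | zero => simp [vermaCoeff_zero]
        | succ i => rfl
      have h2 : (t * (q ^ 2)⁻¹ ^ i) ^ (N - 1) = t⁻¹ * (q ^ 2) ^ i := by
        have h3 := verma_weight_pow hq hodd ht i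
        rw [← Nat.sub_add_cancel hN.le, pow_succ] at h3
        rw [eq_inv_of_mul_eq_one_left h3, mul_inv, inv_pow, inv_inv]
      rw [LinearMap.sub_apply, Module.End.mul_apply, Module.End.mul_apply, h1, vermaF_stdVec,
        vermaE_stdVec hq hodd hN, Nat.add_sub_cancel, LinearMap.smul_apply, LinearMap.sub_apply,
        vermaK_pow_stdVec, vermaK_stdVec, h2, ← sub_smul, ← sub_smul, smul_smul, vermaCoeff,
        Finset.sum_range_succ, vermaCoeff, add_sub_cancel_left])

end Verma

section PBW

variable {k : Type*} [Field k]

namespace SmallUqSl2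

variable {q t : k} {N : ℕ} (hq : IsPrimitiveRoot q N) (hodd : Odd N) (hN : 1 < N)

/-- The second skew primitive element `F K`, with `Δ(F K) = F K ⊗ 1 + K ⊗ F K`. -/
def Y : SmallUqSl2 hq hodd hN := F hq hodd hN * K hq hodd hN

theorem K_mul_Y : K hq hodd hN * Y hq hodd hN = (q ^ 2)⁻¹ • (Y hq hodd hN * K hq hodd hN) := by
  rw [Y, ← mul_assoc, K_mul_F, smul_mul_assoc]

theorem Y_mul_E : Y hq hodd hN * E hq hodd hN = q ^ 2 • (E hq hodd hN * Y hq hodd hN) +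
    (-(q ^ 2 * (q - q⁻¹)⁻¹)) • (K hq hodd hN ^ 2 - 1) := by
  have h1 : F hq hodd hN * E hq hodd hN = E hq hodd hN * F hq hodd hN -
      (q - q⁻¹)⁻¹ • (K hq hodd hN - KInv hq hodd hN) := by
    rw [← E_F]; abel
  rw [Y, mul_assoc, K_mul_E, mul_smul_comm, ← mul_assoc, h1, sub_mul, smul_mul_assoc, sub_mul,
    KInv_mul_K, ← pow_two, mul_assoc]
  module

theorem Y_pow : Y hq hodd hN ^ N = 0 := by
  obtain ⟨c, hc⟩ := qcomm_mul_pow (K_mul_F hq hodd hN) N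
  rw [Y, hc, F_pow, zero_mul, smul_zero]

theorem isSkewPair [NeZero N] : IsSkewPair N (q ^ 2) (-(q ^ 2 * (q - q⁻¹)⁻¹))
    (E hq hodd hN) (Y hq hodd hN) (K hq hodd hN) where
  root_pow := (isPrimitiveRoot_sq hq hodd).pow_eq_one
  K_pow := K_pow hq hodd hN
  K_mul_E := K_mul_E hq hodd hN
  K_mul_Y := K_mul_Y hq hodd hN
  Y_mul_E := Y_mul_E hq hodd hN
  comul_E := comul_E hq hodd hN
  comul_Y := by
    rw [Y, Bialgebra.comul_mul, comul_F, comul_K, add_mul, Algebra.TensorProduct.tmul_mul_tmul,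
      Algebra.TensorProduct.tmul_mul_tmul, KInv_mul_K, one_mul]
  comul_K := comul_K hq hodd hN
  counit_E := counit_E hq hodd hN
  counit_Y := by rw [Y, Bialgebra.counit_mul, counit_F, zero_mul]
  counit_K := counit_K hq hodd hN
  antipode_E := antipode_E hq hodd hN
  antipode_Y := by
    rw [Y, HopfAlgebra.antipode_mul_antidistrib, antipode_F, antipode_K, mul_neg]
    rfl
  antipode_K := antipode_K hq hodd hN

/-- The automorphism exchanging `E` and `F` and inverting `K`. -/
def swapHom : SmallUqSl2 hq hodd hN →ₐ[k] SmallUqSl2 hq hodd hN :=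
  lift hq hodd hN (F hq hodd hN) (E hq hodd hN) (KInv hq hodd hN) (F_pow hq hodd hN)
    (E_pow hq hodd hN) (KInv_pow hq hodd hN) (KInv_mul_F hq hodd hN) (KInv_mul_E hq hodd hN)
    (by rw [KInv_pow_pred, ← neg_sub, E_F, ← smul_neg, neg_sub])

/-- The baby Verma module with lowest weight `1`. -/
def lowestRep : SmallUqSl2 hq hodd hN →ₐ[k] Module.End k (Fin N → k) :=
  (vermaRep hq hodd hN (one_pow N)).comp (swapHom hq hodd hN)

theorem lowestRep_E (i : ℕ) :
    lowestRep hq hodd hN (E hq hodd hN) (stdVec k N i) = stdVec k N (i + 1) := by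
  simp [lowestRep, swapHom, vermaRep, vermaF_stdVec]

theorem lowestRep_K : lowestRep hq hodd hN (K hq hodd hN) (stdVec k N 0) = stdVec k N 0 := by
  simp [lowestRep, swapHom, vermaRep, KInv, vermaK_pow_stdVec]

theorem lowestRep_Y : lowestRep hq hodd hN (Y hq hodd hN) (stdVec k N 0) = 0 := by
  rw [Y, map_mul, Module.End.mul_apply, lowestRep_K]
  simp [lowestRep, swapHom, vermaRep, vermaE_stdVec hq hodd hN, vermaCoeff_zero]

/-- The tensor product of two baby Verma modules, of highest weight `t` and of lowest weight `1`. -/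
def tensorRep (ht : t ^ N = 1) :
    SmallUqSl2 hq hodd hN →ₐ[k] Module.End k ((Fin N → k) ⊗[k] (Fin N → k)) :=
  (Module.endTensorEndAlgHom (R := k) (S := k) (A := k)).comp
    ((Algebra.TensorProduct.map (vermaRep hq hodd hN ht) (lowestRep hq hodd hN)).comp
      (Bialgebra.comulAlgHom k (SmallUqSl2 hq hodd hN)))

variable (ht : t ^ N = 1)

theorem tensorRep_E (v w : Fin N → k) :
    tensorRep hq hodd hN ht (E hq hodd hN) (v ⊗ₜ w) =
      vermaRep hq hodd hN ht (E hq hodd hN) v ⊗ₜ w +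
        vermaRep hq hodd hN ht (K hq hodd hN) v ⊗ₜ lowestRep hq hodd hN (E hq hodd hN) w := by
  simp [tensorRep, comul_E, Module.endTensorEndAlgHom_apply]

theorem tensorRep_Y [NeZero N] (v : Fin N → k) :
    tensorRep hq hodd hN ht (Y hq hodd hN) (v ⊗ₜ stdVec k N 0) =
      vermaRep hq hodd hN ht (Y hq hodd hN) v ⊗ₜ stdVec k N 0 := by
  simp [tensorRep, (isSkewPair hq hodd hN).comul_Y, Module.endTensorEndAlgHom_apply, lowestRep_Y]

theorem tensorRep_K (v : Fin N → k) :
    tensorRep hq hodd hN ht (K hq hodd hN) (v ⊗ₜ stdVec k N 0) =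
      vermaRep hq hodd hN ht (K hq hodd hN) v ⊗ₜ stdVec k N 0 := by
  simp [tensorRep, comul_K, Module.endTensorEndAlgHom_apply, lowestRep_K]

theorem pow_tensorRep_apply {z : SmallUqSl2 hq hodd hN}
    (hz : ∀ v, tensorRep hq hodd hN ht z (v ⊗ₜ stdVec k N 0) =
      vermaRep hq hodd hN ht z v ⊗ₜ stdVec k N 0) (c : ℕ) (v : Fin N → k) :
    tensorRep hq hodd hN ht (z ^ c) (v ⊗ₜ stdVec k N 0) =
      vermaRep hq hodd hN ht (z ^ c) v ⊗ₜ stdVec k N 0 := by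
  induction c with
  | zero => simp
  | succ c ih => rw [pow_succ', map_mul, map_mul, Module.End.mul_apply, ih, hz, Module.End.mul_apply]

/-- The coefficient of the last standard basis vector in the second tensor factor. -/
def lastCoeff :
    (Fin N → k) ⊗[k] (Fin N → k) →ₗ[k] (Fin N → k) :=
  TensorProduct.lift (LinearMap.lsmul k (Fin N → k) ∘ₗ 
    LinearMap.proj ⟨N - 1, Nat.sub_one_lt_of_lt hN⟩).flip

theorem lastCoeff_tmul (v : Fin N → k) (i : ℕ) :
    lastCoeff hN (v ⊗ₜ stdVec k N i) = if i = N - 1 then v else 0 := by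
  simp only [lastCoeff, TensorProduct.lift.tmul, LinearMap.flip_apply, LinearMap.comp_apply,
    LinearMap.proj_apply, LinearMap.lsmul_apply, stdVec, ite_smul, one_smul, zero_smul,
    eq_comm (a := i)]

theorem lastCoeff_E_pow (m : ℕ) : ∀ (i : ℕ) (v : Fin N → k), i + m ≤ N - 1 →
    lastCoeff hN (tensorRep hq hodd hN ht (E hq hodd hN ^ m) (v ⊗ₜ stdVec k N i)) =
      if i + m = N - 1 then vermaRep hq hodd hN ht (K hq hodd hN ^ m) v else 0 := by
  induction m with
  | zero => intro i v _; simp [lastCoeff_tmul]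
  | succ m ih =>
    intro i v h
    rw [pow_succ, map_mul, Module.End.mul_apply, tensorRep_E, lowestRep_E, map_add, map_add,
      ih _ _ (by omega), ih _ _ (by omega), if_neg (by omega), zero_add, pow_succ, map_mul,
      Module.End.mul_apply, add_assoc, add_comm 1 m]

theorem vermaRep_K_pow (m i : ℕ) : vermaRep hq hodd hN ht (K hq hodd hN ^ m) (stdVec k N i) =
    (t * (q ^ 2)⁻¹ ^ i) ^ m • stdVec k N i := by
  simp [vermaRep, vermaK_pow_stdVec]

theorem vermaRep_Y_pow (c : ℕ) : ∃ s : k, s ≠ 0 ∧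
    vermaRep hq hodd hN ht (Y hq hodd hN ^ c) (stdVec k N 0) = s • stdVec k N c := by
  have ht0 : t ≠ 0 := by
    rintro rfl
    simp [zero_pow (show N ≠ 0 by omega)] at ht
  induction c with
  | zero => exact ⟨1, one_ne_zero, by simp⟩
  | succ c ih =>
    obtain ⟨s, hs, h⟩ := ih
    refine ⟨s * (t * (q ^ 2)⁻¹ ^ c), mul_ne_zero hs (mul_ne_zero ht0
      (pow_ne_zero _ (inv_ne_zero (sq_ne_zero hq hN)))), ?_⟩
    rw [pow_succ', map_mul, Module.End.mul_apply, h]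
    simp [Y, vermaRep, vermaK_stdVec, vermaF_stdVec, smul_smul]

theorem exists_functional {μ : k} (hμ : μ ^ N = 1) :
    ∃ (φ : SmallUqSl2 hq hodd hN →ₗ[k] k) (s : k), s ≠ 0 ∧ ∀ j : ℕ,
      φ (E hq hodd hN ^ (N - 1) * K hq hodd hN ^ j * Y hq hodd hN ^ (N - 1)) = s * μ ^ j := by
  have : NeZero N := ⟨by omega⟩
  have hz := sq_ne_zero hq hN
  set t : k := μ * (q ^ 2) ^ (N - 1) with ht_def
  have ht : t ^ N = 1 := by
    rw [ht_def, mul_pow, hμ, ← pow_mul, mul_comm (N - 1), pow_mul, (isPrimitiveRoot_sq hq hodd).pow_eq_one,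
      one_pow, one_mul]
  have hwt : t * (q ^ 2)⁻¹ ^ (N - 1) = μ := by
    rw [ht_def, mul_assoc, ← mul_pow, mul_inv_cancel₀ hz, one_pow, mul_one]
  have hμ0 : μ ≠ 0 := by
    rintro rfl
    simp [zero_pow (NeZero.ne N)] at hμ
  obtain ⟨s, hs, hY⟩ := vermaRep_Y_pow hq hodd hN ht (N - 1)
  refine ⟨LinearMap.proj (⟨N - 1, by omega⟩ : Fin N) ∘ₗ lastCoeff hN ∘ₗ
    LinearMap.applyₗ (stdVec k N 0 ⊗ₜ stdVec k N 0) ∘ₗ (tensorRep hq hodd hN ht).toLinearMap,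
    s * μ ^ (N - 1), mul_ne_zero hs (pow_ne_zero _ hμ0), fun j => ?_⟩
  simp only [LinearMap.comp_apply, LinearMap.applyₗ_apply_apply, AlgHom.toLinearMap_apply]
  rw [map_mul, map_mul, Module.End.mul_apply, Module.End.mul_apply,
    pow_tensorRep_apply hq hodd hN ht (tensorRep_Y hq hodd hN ht), hY,
    pow_tensorRep_apply hq hodd hN ht (tensorRep_K hq hodd hN ht), map_smul, vermaRep_K_pow, hwt,
    lastCoeff_E_pow hq hodd hN ht _ _ _ (by omega), if_pos (by omega), map_smul, map_smul,
    map_smul, vermaRep_K_pow, hwt]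
  simp [stdVec]
  ring

end SmallUqSl2

end PBW

section Bases

variable {k : Type*} [Field k]

namespace SmallUqSl2

variable {q : k} {N : ℕ} (hq : IsPrimitiveRoot q N) (hodd : Odd N) (hN : 1 < N)

theorem span_monomial : Submodule.span k (Set.range fun p : (Fin N × Fin N) × ZMod N =>
    monomial (E hq hodd hN) (Y hq hodd hN) (K hq hodd hN) p.1.1 p.1.2 p.2) = ⊤ := by
  rw [eq_top_iff, ← span_monomials, Submodule.span_le]
  rintro _ ⟨⟨i, l, r⟩, rfl⟩
  have hF : F hq hodd hN = Y hq hodd hN * KInv hq hodd hN := by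
    rw [Y, mul_assoc, K_mul_KInv, mul_one]
  have hcomm : KInv hq hodd hN * Y hq hodd hN = q ^ 2 • (Y hq hodd hN * KInv hq hodd hN) := by
    rw [Y, ← mul_assoc, KInv_mul_F, smul_mul_assoc, mul_assoc, KInv_mul_K, mul_assoc, K_mul_KInv]
  obtain ⟨s, hs⟩ := qcomm_mul_pow hcomm l
  have e : E hq hodd hN ^ (i : ℕ) * F hq hodd hN ^ (l : ℕ) * K hq hodd hN ^ (r : ℕ) =
      s • monomial (E hq hodd hN) (Y hq hodd hN) (K hq hodd hN) i l
        (((N - 1) * l + r : ℕ) : ZMod N) := by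
    rw [monomial, modPow_natCast (K_pow hq hodd hN), hF, hs, mul_smul_comm, smul_mul_assoc, KInv,
      pow_add, pow_mul]
    simp only [mul_assoc]
  simp only [SetLike.mem_coe]
  rw [e]
  exact Submodule.smul_mem _ _ (Submodule.subset_span ⟨((i, l), _), rfl⟩)

variable [NeZero N]

theorem eq_zero_of_sum_K [CharZero k] {x : ZMod N → k}
    (hx : ∑ j, x j • (E hq hodd hN ^ (N - 1) * modPow (K hq hodd hN) j *
      Y hq hodd hN ^ (N - 1)) = 0) (j : ZMod N) : x j = 0 := by
  have hω := isPrimitiveRoot_sq hq hodd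
  refine eq_zero_of_sum_char_eq_zero hω (fun r => ?_) j
  have hμ : modPow (q ^ 2) r ^ N = 1 := by
    rw [modPow, ← pow_mul, mul_comm, pow_mul, hω.pow_eq_one, one_pow]
  obtain ⟨φ, s, hs, hφ⟩ := exists_functional hq hodd hN hμ
  have h1 := congrArg φ hx
  simp only [map_sum, map_smul, modPow, hφ, smul_eq_mul, map_zero] at h1
  refine (mul_eq_zero.mp ?_).resolve_left hs
  rw [Finset.mul_sum, ← h1]
  exact Finset.sum_congr rfl fun j _ => by rw [modPow]; ring

theorem eq_zero_of_sum_Y_K [CharZero k] {x : Fin N → ZMod N → k}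
    (hx : ∑ c : Fin N, ∑ j, x c j • (E hq hodd hN ^ (N - 1) *
      (Y hq hodd hN ^ (c : ℕ) * modPow (K hq hodd hN) j)) = 0) (c : Fin N) (j : ZMod N) :
    x c j = 0 := by
  have h := isSkewPair hq hodd hN
  have hχ : ∀ i j : ZMod N, modPow (q ^ 2) (i + j) = modPow (q ^ 2) i * modPow (q ^ 2) j :=
    h.scalar_add
  have hχ0 : ∀ i : ZMod N, modPow (q ^ 2) i ≠ 0 := fun i => pow_ne_zero _ (sq_ne_zero hq hN)
  set m : Fin N → SmallUqSl2 hq hodd hN := fun c =>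
    ∑ j, (x c j * modPow (q ^ 2) (j * (c : ℕ) : ZMod N)) •
      (E hq hodd hN ^ (N - 1) * modPow (K hq hodd hN) j) with hm_def
  have hzero : ∀ c, m c * Y hq hodd hN ^ (N - 1) = 0 → ∀ j, x c j = 0 := by
    intro c hc j
    rw [hm_def, Finset.sum_mul] at hc
    simp only [smul_mul_assoc] at hc
    exact (mul_eq_zero.mp (eq_zero_of_sum_K hq hodd hN hc j)).resolve_right (hχ0 _)
  have hT : LinearMap.mulRight k (Y hq hodd hN) ^ N = 0 := by
    rw [LinearMap.pow_mulRight, Y_pow, LinearMap.mulRight_zero_eq_zero]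
  refine hzero c ?_ j
  have := pow_apply_eq_zero_of_sum_eq_zero (k := k) hT (m := m) ?_ ?_ c
  · rwa [LinearMap.pow_mulRight, LinearMap.mulRight_apply] at this
  · intro c hc
    rw [LinearMap.pow_mulRight, LinearMap.mulRight_apply] at hc
    rw [hm_def]
    exact Finset.sum_eq_zero fun j _ => by rw [hzero c hc j, zero_mul, zero_smul]
  · rw [← hx]
    refine Finset.sum_congr rfl fun c _ => ?_
    rw [LinearMap.pow_mulRight, LinearMap.mulRight_apply, hm_def, Finset.sum_mul]
    refine Finset.sum_congr rfl fun j _ => ?_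
    rw [smul_mul_assoc, mul_assoc, h.modPow_K_mul_Y_pow, mul_smul_comm, smul_smul, mul_assoc,
      ← hχ, add_neg_cancel, modPow_zero, mul_one]

theorem linearIndependent_monomial [CharZero k] :
    LinearIndependent k fun p : (Fin N × Fin N) × ZMod N =>
      monomial (E hq hodd hN) (Y hq hodd hN) (K hq hodd hN) p.1.1 p.1.2 p.2 := by
  rw [Fintype.linearIndependent_iff]
  rintro x hx ⟨⟨a, c⟩, j⟩
  simp only [Fintype.sum_prod_type] at hx
  set m : Fin N → SmallUqSl2 hq hodd hN := fun a =>
    ∑ c : Fin N, ∑ j, x ((a, c), j) • (Y hq hodd hN ^ (c : ℕ) * modPow (K hq hodd hN) j)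
    with hm_def
  have hzero : ∀ a, E hq hodd hN ^ (N - 1) * m a = 0 → ∀ c j, x ((a, c), j) = 0 := by
    intro a ha
    rw [hm_def] at ha
    simp only [Finset.mul_sum, mul_smul_comm] at ha
    exact eq_zero_of_sum_Y_K hq hodd hN ha
  have hT : LinearMap.mulLeft k (E hq hodd hN) ^ N = 0 := by
    rw [LinearMap.pow_mulLeft, E_pow, LinearMap.mulLeft_zero_eq_zero]
  refine hzero a ?_ c j
  have := pow_apply_eq_zero_of_sum_eq_zero (k := k) hT (m := m) ?_ ?_ a
  · rwa [LinearMap.pow_mulLeft, LinearMap.mulLeft_apply] at this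
  · intro a ha
    rw [LinearMap.pow_mulLeft, LinearMap.mulLeft_apply] at ha
    rw [hm_def]
    exact Finset.sum_eq_zero fun c _ => Finset.sum_eq_zero fun j _ => by
      rw [hzero a ha c j, zero_smul]
  · rw [← hx]
    refine Finset.sum_congr rfl fun a _ => ?_
    rw [LinearMap.pow_mulLeft, LinearMap.mulLeft_apply, hm_def, Finset.mul_sum]
    refine Finset.sum_congr rfl fun c _ => ?_
    rw [Finset.mul_sum]
    refine Finset.sum_congr rfl fun j _ => ?_
    rw [mul_smul_comm, monomial, mul_assoc]

/-- The basis of monomials `E ^ a (F K) ^ c K ^ j`. -/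
def monomialBasis [CharZero k] :
    Module.Basis ((Fin N × Fin N) × ZMod N) k (SmallUqSl2 hq hodd hN) :=
  Module.Basis.mk (linearIndependent_monomial hq hodd hN) (span_monomial hq hodd hN).ge

theorem monomialBasis_apply [CharZero k] (i : Fin N × Fin N) (j : ZMod N) :
    monomialBasis hq hodd hN (i, j) =
      monomial (E hq hodd hN) (Y hq hodd hN) (K hq hodd hN) i.1 i.2 j := by
  rw [monomialBasis, Module.Basis.mk_apply]

theorem monomialBasis_repr_eq_zero [CharZero k] (i : Fin N × Fin N) (j : ZMod N)
    {u : SmallUqSl2 hq hodd hN}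
    (hu : u ∈ degreeLT k N (E hq hodd hN) (Y hq hodd hN) (K hq hodd hN) (i.1 + i.2)) :
    (monomialBasis hq hodd hN).repr u (i, j) = 0 := by
  have hle : degreeLT k N (E hq hodd hN) (Y hq hodd hN) (K hq hodd hN) (i.1 + i.2) ≤
      LinearMap.ker ((monomialBasis hq hodd hN).coord (i, j)) := by
    refine Submodule.span_le.mpr ?_
    rintro _ ⟨a, c, l, hlt, rfl⟩
    rw [SetLike.mem_coe, LinearMap.mem_ker, Module.Basis.coord_apply]
    by_cases ha : a < N
    · by_cases hc : c < N
      · rw [← monomialBasis_apply hq hodd hN (⟨a, ha⟩, ⟨c, hc⟩) l, Module.Basis.repr_self,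
          Finsupp.single_eq_of_ne]
        rintro h
        rw [Prod.mk.injEq] at h
        rw [h.1] at hlt
        exact lt_irrefl _ hlt
      · rw [monomial, pow_eq_zero_of_le (not_lt.mp hc) (Y_pow hq hodd hN), mul_zero, zero_mul,
          map_zero, Finsupp.zero_apply]
    · rw [monomial, pow_eq_zero_of_le (not_lt.mp ha) (E_pow hq hodd hN), zero_mul, zero_mul,
        map_zero, Finsupp.zero_apply]
  exact hle hu

end SmallUqSl2

namespace TaftAlgebra

theorem isSkewPair {ω : k} {N : ℕ} (hω : IsPrimitiveRoot ω N) (hN : 1 < N) :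
    IsSkewPair N ω 0 (x hω hN) 0 (g hω hN) where
  root_pow := hω.pow_eq_one
  K_pow := g_pow hω hN
  K_mul_E := g_mul_x hω hN
  K_mul_Y := by simp
  Y_mul_E := by simp
  comul_E := comul_x hω hN
  comul_Y := by simp
  comul_K := comul_g hω hN
  counit_E := counit_x hω hN
  counit_Y := by simp
  counit_K := counit_g hω hN
  antipode_E := antipode_x hω hN
  antipode_Y := by simp
  antipode_K := antipode_g hω hN

theorem span_monomial {ω : k} {N : ℕ} (hω : IsPrimitiveRoot ω N) (hN : 1 < N) : Submodule.span k (Set.range fun p : Fin N × ZMod N =>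
    monomial (x hω hN) 0 (g hω hN) p.1 0 p.2) = ⊤ := by
  rw [eq_top_iff, ← span_monomials, Submodule.span_le]
  rintro _ ⟨⟨i, l⟩, rfl⟩
  refine Submodule.subset_span ⟨(i, ((l : ℕ) : ZMod N)), ?_⟩
  simp only [monomial, pow_zero, mul_one, modPow_natCast (g_pow hω hN)]

variable {q : k} {N : ℕ} (hq : IsPrimitiveRoot q N) (hodd : Odd N) (hN : 1 < N) [NeZero N]

/-- The embedding of the Taft algebra as the positive part of `u_q(sl₂)`. -/
def toSmallUqSl2 : TaftAlgebra (isPrimitiveRoot_sq hq hodd) hN →ₐ[k] SmallUqSl2 hq hodd hN :=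
  lift _ hN (SmallUqSl2.E hq hodd hN) (SmallUqSl2.K hq hodd hN) (SmallUqSl2.E_pow hq hodd hN)
    (SmallUqSl2.K_pow hq hodd hN) (SmallUqSl2.K_mul_E hq hodd hN)

theorem linearIndependent_monomial [CharZero k] :
    LinearIndependent k fun p : Fin N × ZMod N =>
      monomial (x (isPrimitiveRoot_sq hq hodd) hN) 0 (g (isPrimitiveRoot_sq hq hodd) hN)
        p.1 0 p.2 := by
  refine LinearIndependent.of_comp (toSmallUqSl2 hq hodd hN).toLinearMap ?_
  have h := (SmallUqSl2.linearIndependent_monomial hq hodd hN).comp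
    (fun p : Fin N × ZMod N => ((p.1, 0), p.2)) (fun p r h => by
      simp only [Prod.mk.injEq, and_true] at h
      exact Prod.ext h.1 h.2)
  convert h using 1
  ext p
  simp [monomial, modPow, toSmallUqSl2]

/-- The basis of monomials `x ^ a g ^ j`. -/
def monomialBasis [CharZero k] :
    Module.Basis (Fin N × ZMod N) k (TaftAlgebra (isPrimitiveRoot_sq hq hodd) hN) :=
  Module.Basis.mk (linearIndependent_monomial hq hodd hN) (span_monomial _ hN).ge

theorem monomialBasis_apply [CharZero k] (i : Fin N) (j : ZMod N) :
    monomialBasis hq hodd hN (i, j) =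
      monomial (x (isPrimitiveRoot_sq hq hodd) hN) 0 (g (isPrimitiveRoot_sq hq hodd) hN) i 0 j := by
  rw [monomialBasis, Module.Basis.mk_apply]

theorem monomialBasis_repr_eq_zero [CharZero k] (i : Fin N) (j : ZMod N)
    {u : TaftAlgebra (isPrimitiveRoot_sq hq hodd) hN}
    (hu : u ∈ degreeLT k N (x (isPrimitiveRoot_sq hq hodd) hN) 0
      (g (isPrimitiveRoot_sq hq hodd) hN) (i + 0)) :
    (monomialBasis hq hodd hN).repr u (i, j) = 0 := by
  have hle : degreeLT k N (x (isPrimitiveRoot_sq hq hodd) hN) 0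
      (g (isPrimitiveRoot_sq hq hodd) hN) (i + 0) ≤
      LinearMap.ker ((monomialBasis hq hodd hN).coord (i, j)) := by
    refine Submodule.span_le.mpr ?_
    rintro _ ⟨a, c, l, hlt, rfl⟩
    rw [SetLike.mem_coe, LinearMap.mem_ker, Module.Basis.coord_apply]
    by_cases hc : c = 0
    · subst hc
      have ha : a < N := by have := i.2; omega
      rw [← monomialBasis_apply hq hodd hN ⟨a, ha⟩ l, Module.Basis.repr_self,
        Finsupp.single_eq_of_ne]
      rintro h
      rw [Prod.mk.injEq] at h
      rw [h.1] at hlt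
      exact lt_irrefl _ hlt
    · rw [monomial, zero_pow hc, mul_zero, zero_mul, map_zero, Finsupp.zero_apply]
  exact hle hu

end TaftAlgebra

end Bases

/-! ### The indicators -/

section Indicators

variable {k : Type*} [Field k] [CharZero k] {q : k} {N : ℕ} [NeZero N]

theorem indicator_taftAlgebra (hq : IsPrimitiveRoot q N) (hodd : Odd N) (hN : 1 < N) (n : ℕ)
    (hn : 1 ≤ n) :
    indicator k (TaftAlgebra (isPrimitiveRoot_sq hq hodd) hN) n =
      ∑ a : Fin N, ∑ B : ZMod N, taftTerm (q ^ 2) n a B := by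
  rw [(TaftAlgebra.isSkewPair (isPrimitiveRoot_sq hq hodd) hN).indicator_eq
    (TaftAlgebra.monomialBasis hq hodd hN) (fun i => i) (fun _ => 0)
    (TaftAlgebra.monomialBasis_apply hq hodd hN)
    (fun i j u hu => TaftAlgebra.monomialBasis_repr_eq_zero hq hodd hN i j hu) n hn]
  refine Finset.sum_congr rfl fun a _ => Finset.sum_congr rfl fun B _ => ?_
  rw [Finset.sum_eq_single 0]
  · simp [sweedlerCoeff_zero_right, taftTerm, modPow]
  · intro D _ hD
    simp [sweedlerCoeff_zero_right, hD]
  · simp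

theorem gcd_mul_indicator_smallUqSl2 (hq : IsPrimitiveRoot q N) (hodd : Odd N) (hN : 1 < N)
    (n : ℕ) (hn : 1 ≤ n) :
    (Nat.gcd N n : k) * indicator k (SmallUqSl2 hq hodd hN) n =
      (∑ a : Fin N, ∑ B : ZMod N, taftTerm (q ^ 2) n a B) *
        ∑ c : Fin N, ∑ D : ZMod N, taftTerm (q ^ 2)⁻¹ n c D := by
  have hω := isPrimitiveRoot_sq hq hodd
  have hχ : ∀ i : ZMod N, AddChar.zmodChar N hω.pow_eq_one i = 1 → i = 0 := by
    intro i hi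
    rw [AddChar.zmodChar_apply, hω.pow_eq_one_iff_dvd] at hi
    rw [← ZMod.natCast_zmod_val i, ZMod.natCast_eq_zero_iff]
    exact hi
  rw [(SmallUqSl2.isSkewPair hq hodd hN).indicator_eq
    (SmallUqSl2.monomialBasis hq hodd hN) (fun i => i.1) (fun i => i.2)
    (SmallUqSl2.monomialBasis_apply hq hodd hN)
    (fun i j u hu => SmallUqSl2.monomialBasis_repr_eq_zero hq hodd hN i j hu) n hn,
    Fintype.sum_prod_type, Finset.sum_mul_sum, Finset.mul_sum]
  refine Finset.sum_congr rfl fun a _ => ?_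
  rw [Finset.mul_sum]
  refine Finset.sum_congr rfl fun c _ => ?_
  rw [Finset.sum_mul_sum, Finset.mul_sum]
  refine Finset.sum_congr rfl fun B _ => ?_
  rw [Finset.mul_sum]
  refine Finset.sum_congr rfl fun D _ => ?_
  have h1 := sum_fibre_mul_sum_fibre hodd hχ n (B + (a : ℕ)) (D + (c : ℕ))
  have h2 : ∀ i : ZMod N, (q ^ 2)⁻¹ ^ i.val = (q ^ 2) ^ (-i).val := fun i =>
    modPow_inv hω.pow_eq_one i
  simp only [AddChar.zmodChar_apply] at h1
  simp only [taftTerm, modPow, h2]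
  linear_combination -((-1) ^ (a : ℕ) * (q ^ 2) ^ (a : ℕ).choose 2 *
    sweedlerCoeff (q ^ 2) (n - 1) a B *
    ((-1) ^ (c : ℕ) * (q ^ 2)⁻¹ ^ (c : ℕ).choose 2 * sweedlerCoeff (q ^ 2)⁻¹ (n - 1) c D)) * h1

end Indicators

end

end HopfIndicator

theorem mainTheorem10 {k : Type*} [Field k] [IsAlgClosed k] [CharZero k] {q : k} {N : ℕ}
    (hq : IsPrimitiveRoot q N) (hodd : Odd N) (hN : 1 < N) (n : ℕ) (hn : 1 ≤ n) :
    ∃ h : HopfIndicator.indicator k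
        (HopfIndicator.TaftAlgebra (HopfIndicator.isPrimitiveRoot_sq hq hodd) hN) n ∈
          HopfIndicator.cyclotomicSubring k,
      HopfIndicator.indicator k (HopfIndicator.SmallUqSl2 hq hodd hN) n =
        1 / (Nat.gcd N n : k) * HopfIndicator.absSq ⟨_, h⟩ := by
  have : NeZero N := ⟨by omega⟩
  have hpair := HopfIndicator.IsConjPair.of_isPrimitiveRoot
    (HopfIndicator.isPrimitiveRoot_sq hq hodd)
  have hsum := HopfIndicator.IsConjPair.sum Finset.univ fun (a : Fin N) _ =>
    HopfIndicator.IsConjPair.sum Finset.univ fun (B : ZMod N) _ => hpair.taftTerm n a B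
  rw [← HopfIndicator.indicator_taftAlgebra hq hodd hN n hn] at hsum
  obtain ⟨h, habs⟩ := hsum.exists_absSq_eq
  refine ⟨h, ?_⟩
  have hgcd : (Nat.gcd N n : k) ≠ 0 :=
    Nat.cast_ne_zero.mpr (Nat.gcd_pos_of_pos_left _ (by omega)).ne'
  rw [habs, HopfIndicator.indicator_taftAlgebra hq hodd hN n hn,
    ← HopfIndicator.gcd_mul_indicator_smallUqSl2 hq hodd hN n hn, one_div,
    inv_mul_cancel_left₀ hgcd]
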